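/- Let $K\ge 1$, $b_1,\dots,b_K\in\{1,2,\dots\}$, $B=\sum_k b_k$, let $\lambda_1,\dots,\lambda_K>0$ be request rates and $a_k=\lambda_k/\sum_j\lambda_j$. Let $F_1,\dots,F_K$ be continuous distribution functions on $[0,1]$ with $F_k(0)=0$, $F_k(1)=1$, continuously differentiable on $(0,1)$ ($F_k'$ may be unbounded near the end points). Let each utility $U_k:[0,\infty)\to[-\infty,\infty)$ be increasing and concave, and finite on $(0,\infty)$. Let $\beta\ge 0$. For $n\ge1$, provider $k$ serves $b_kn$ unit-size files, different from those of the other providers, with popularities $p^{(n)}_{k,i}=F_k\bigl(\tfrac{i}{b_kn}\bigr)-F_k\bigl(\tfrac{i-1}{b_kn}\bigr)$, $1\le i\le b_kn$. File $i$ of provider $k$ is requested according to a Poisson process of rate $\lambda_kp^{(n)}_{k,i}$, independently of the others, so that successive requests are independent and each is for this file with probability $a_kp^{(n)}_{k,i}$. The hit rate $h_k$ of provider $k$ is $\lambda_k$ times the steady-state probability (the limit, as the number of earlier requests tends to infinity, starting from an empty cache) that a request to provider $k$ finds its file in the LRU cache that serves it. Asymptotic quantities. For a partition that can hold the fraction $\beta_k\ge0$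 of the files of provider $k$, put $\mu_k(\beta_k)=\int_0^1F_k'(x)e^{-F_k'(x)\tau_k}\,dx$, where $\tau_k\ge0$ solves $\beta_k=\int_0^1(1-e^{-F_k'(x)\tau_k})\,dx$. For a shared cache that can hold the fraction $\beta$ of all files, put $\mu^{(s)}_k(\beta)=\int_0^1F_k'(x)e^{-a_kF_k'(x)\tau_0B/b_k}\,dx$, where $\tau_0\ge0$ solves $\beta=1-\sum_k\frac{b_k}{B}\int_0^1e^{-a_kF_k'(x)\tau_0B/b_k}\,dx$. If the cache is so large that the respective equation has no solution, the miss probabilities $\mu_k(\beta_k)$, respectively all $\mu_k^{(s)}(\beta)$, are $0$. Put $$U^{(s)}=\sum_kU_k\bigl(\lambda_k(1-\mu_k^{(s)}(\beta))\bigr),\qquad U^{(p)}(\beta_1,\dots,\beta_K)=\sum_kU_k\bigl(\lambda_k(1-\mu_k(\beta_k))\bigr),$$ and call $(\beta_1,\dots,\beta_K)$ feasible if all $\beta_k\ge0$ and $\sum_k\frac{b_k}{B}\beta_k=\beta$. Then: 1. If all providers share one LRU cache of size $C^{(n)}=\lfloor\beta Bn\rfloor$, then $\sum_kU_k(h_k)\to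 U^{(s)}$ as $n\to\infty$. 2. If provider $k$ has its own LRU partition of size $\lfloor\beta_kb_kn\rfloor$ for every $k$, with $(\beta_k)$ feasible, then $\sum_kU_k(h_k)\to U^{(p)}(\beta_1,\dots,\beta_K)$. 3. There is a feasible $(\beta_k)$ with $U^{(p)}(\beta_1,\dots,\beta_K)\ge U^{(s)}$; in particular $\sup_{(\beta_k)\text{ feasible}}U^{(p)}(\beta_1,\dots,\beta_K)\ge U^{(s)}$. Likewise, the $\liminf$ as $n\to\infty$ of the supremum of $\sum_kU_k(h_k)$ over all LRU partitions with integer sizes $C_1+\dots+C_K\le C^{(n)}$ is at least $U^{(s)}$. -/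

import Mathlib

open Filter Topology Set

noncomputable section

namespace LRUCache

/-! ### The LRU policy under independent requests -/

section LRU

variable {ι : Type*} [DecidableEq ι]

/-- One request `x` to an LRU cache of capacity `C`; the content `s` is listed from the most to the
least recently used file. The requested file moves (or is inserted) to the front, and the file at
the end is evicted if the capacity is exceeded. -/
def step (C : ℕ) (s : List ι) (x : ι) : List ι := (x :: s.erase x).take C

/-- The content of an initially empty LRU cache after the requests `w` (in chronological order). -/
def content (C : ℕ) (w : List ι) : List ι := w.foldl (step C) []

variable [Fintype ι]

/-- The probability that file `i` is in the cache after `t` independent requests, each of which is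
for file `j` with probability `q j`. -/
def cachedProbAfter (C : ℕ) (q : ι → ℝ) (t : ℕ) (i : ι) : ℝ :=
  ∑ w : Fin t → ι, (∏ s, q (w s)) * (if i ∈ content C (List.ofFn w) then 1 else 0)

/-- The steady-state probability that file `i` is in the cache
(the limit exists, see `tendsto_cachedProb`). -/
def cachedProb (C : ℕ) (q : ι → ℝ) (i : ι) : ℝ :=
  limUnder atTop (fun t => cachedProbAfter C q t i)

end LRU

theorem step_prefix {ι : Type*} [DecidableEq ι] (C : ℕ) {s s' : List ι} (h : s <+: s') (x : ι) :
    step C s x <+: step C s' x := by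
  obtain ⟨r, rfl⟩ := h
  refine List.IsPrefix.take ?_ C
  rw [List.cons_prefix_cons]
  refine ⟨rfl, ?_⟩
  rw [List.erase_append]
  split_ifs with hx
  · exact List.prefix_append _ _
  · rw [List.erase_of_not_mem hx]
    exact List.prefix_append _ _

theorem foldl_step_prefix {ι : Type*} [DecidableEq ι] (C : ℕ) (w : List ι) :
    ∀ {s s' : List ι}, s <+: s' → w.foldl (step C) s <+: w.foldl (step C) s' := by
  induction w with
  | nil => intro s s' h; simpa using h
  | cons x w ih => intro s s' h; exact ih (step_prefix C h x)

theorem cachedProbAfter_le_succ {ι : Type*} [DecidableEq ι] [Fintype ι] (C : ℕ) {q : ι → ℝ}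
    (hq : ∀ j, 0 ≤ q j) (hq1 : ∑ j, q j = 1) (i : ι) (t : ℕ) :
    cachedProbAfter C q t i ≤ cachedProbAfter C q (t + 1) i := by
  unfold cachedProbAfter
  rw [← (Fin.consEquiv fun _ : Fin (t + 1) => ι).sum_comp, Fintype.sum_prod_type]
  calc _ = ∑ x : ι, q x * ∑ w : Fin t → ι, (∏ s, q (w s)) *
        (if i ∈ content C (List.ofFn w) then 1 else 0) := by rw [← Finset.sum_mul, hq1, one_mul]
    _ ≤ _ := by
      refine Finset.sum_le_sum fun x _ => ?_
      rw [Finset.mul_sum]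
      refine Finset.sum_le_sum fun w _ => ?_
      have hp : 0 ≤ ∏ s, q (w s) := Finset.prod_nonneg fun s _ => hq _
      have hsub : i ∈ content C (List.ofFn w) → i ∈ content C (x :: List.ofFn w) := fun h =>
        (foldl_step_prefix C (List.ofFn w) (List.nil_prefix (l := step C [] x))).subset h
      simp only [Fin.consEquiv_apply, Fin.prod_univ_succ, Fin.cons_zero, Fin.cons_succ,
        List.ofFn_succ]
      rw [mul_assoc]
      refine mul_le_mul_of_nonneg_left (mul_le_mul_of_nonneg_left ?_ hp) (hq x)
      split_ifs with h1 h2 h2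
      · exact le_rfl
      · exact absurd (hsub h1) h2
      · exact zero_le_one
      · exact le_rfl

theorem cachedProbAfter_le_one {ι : Type*} [DecidableEq ι] [Fintype ι] (C : ℕ) {q : ι → ℝ}
    (hq : ∀ j, 0 ≤ q j) (hq1 : ∑ j, q j = 1) (i : ι) (t : ℕ) :
    cachedProbAfter C q t i ≤ 1 := by
  unfold cachedProbAfter
  calc _ ≤ ∑ w : Fin t → ι, ∏ s, q (w s) := by
        refine Finset.sum_le_sum fun w _ => ?_
        have hp : 0 ≤ ∏ s, q (w s) := Finset.prod_nonneg fun s _ => hq _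
        split_ifs <;> simp [hp]
    _ = ∏ _s : Fin t, ∑ j, q j := (Fintype.prod_sum fun _ j => q j).symm
    _ = 1 := by simp [hq1]

/-- For a request distribution `q` the limit that defines `cachedProb` exists. -/
theorem tendsto_cachedProb {ι : Type*} [DecidableEq ι] [Fintype ι] (C : ℕ) {q : ι → ℝ}
    (hq : ∀ j, 0 ≤ q j) (hq1 : ∑ j, q j = 1) (i : ι) :
    Tendsto (fun t => cachedProbAfter C q t i) atTop (𝓝 (cachedProb C q i)) :=
  tendsto_nhds_limUnder ⟨_, tendsto_atTop_ciSup
    (monotone_nat_of_le_succ (cachedProbAfter_le_succ C hq hq1 i))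
    ⟨1, by rintro _ ⟨t, rfl⟩; exact cachedProbAfter_le_one C hq hq1 i t⟩⟩

/-! ### Popularities, request rates, utilities -/

/-- An asymptotic popularity distribution: a continuous distribution function on `[0, 1]` that is
continuously differentiable in `(0, 1)`; the derivative may blow up at the end points. -/
structure IsPopularity (F : ℝ → ℝ) : Prop where
  zero : F 0 = 0
  one : F 1 = 1
  mono : MonotoneOn F (Icc 0 1)
  cont : ContinuousOn F (Icc 0 1)
  contDiff : ContDiffOn ℝ 1 F (Ioo 0 1)

/-- A utility: an increasing concave function of the hit rate `h ≥ 0`, finite for `h > 0`; at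
`h = 0` the value `-∞` is allowed, as for `log`. (By monotonicity, concavity on `(0, ∞)` amounts to
concavity on `[0, ∞)`.) -/
structure IsUtility (U : ℝ → EReal) : Prop where
  finite : ∀ h, 0 < h → U h ≠ ⊥ ∧ U h ≠ ⊤
  mono : MonotoneOn U (Ici 0)
  concave : ConcaveOn ℝ (Ioi 0) (fun h => (U h).toReal)

/-- The popularities of `m` files, `F (i / m) - F ((i - 1) / m)` for `i = 1, …, m`
(the index `i` here is shifted by one). -/
def popularity (F : ℝ → ℝ) (m : ℕ) (i : Fin m) : ℝ :=
  F (((i : ℕ) + 1 : ℝ) / m) - F (((i : ℕ) : ℝ) / m)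

variable {K : ℕ}

/-- `B = b_1 + … + b_K`. -/
def total (b : Fin K → ℕ) : ℝ := ∑ k, (b k : ℝ)

/-- `a_k = λ_k / (λ_1 + … + λ_K)`: the probability that a request is addressed to provider `k`. -/
def share (lam : Fin K → ℝ) (k : Fin K) : ℝ := lam k / ∑ j, lam j

/-! ### Finite systems -/

/-- Provider `k` has `b k * n` files, and the files of different providers are distinct. A request
is for file `i` of provider `k` with probability `a_k p_{k,i}` (the law of the successive requests
of independent Poisson processes with the rates `λ_k p_{k,i}`). -/
def requestLaw (b : Fin K → ℕ) (lam : Fin K → ℝ) (F : Fin K → ℝ → ℝ) (n : ℕ)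
    (f : Σ k, Fin (b k * n)) : ℝ :=
  share lam f.1 * popularity (F f.1) (b f.1 * n) f.2

/-- The hit rate of provider `k` when all providers share one LRU cache of size `C`. -/
def sharedHitRate (b : Fin K → ℕ) (lam : Fin K → ℝ) (F : Fin K → ℝ → ℝ) (n C : ℕ) (k : Fin K) :
    ℝ :=
  lam k * ∑ i, popularity (F k) (b k * n) i * cachedProb C (requestLaw b lam F n) ⟨k, i⟩

/-- The hit rate of provider `k` when it has an LRU cache of size `C` of its own. -/
def partitionHitRate (b : Fin K → ℕ) (lam : Fin K → ℝ) (F : Fin K → ℝ → ℝ) (n C : ℕ) (k : Fin K) :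
    ℝ :=
  lam k * ∑ i, popularity (F k) (b k * n) i * cachedProb C (popularity (F k) (b k * n)) i

/-- The sum of utilities with a shared LRU cache of size `C`. -/
def sharedUtility (b : Fin K → ℕ) (lam : Fin K → ℝ) (F : Fin K → ℝ → ℝ) (U : Fin K → ℝ → EReal)
    (n C : ℕ) : EReal :=
  ∑ k, U k (sharedHitRate b lam F n C k)

/-- The sum of utilities when provider `k` has an LRU partition of size `C k`. -/
def partitionUtility (b : Fin K → ℕ) (lam : Fin K → ℝ) (F : Fin K → ℝ → ℝ)
    (U : Fin K → ℝ → EReal) (n : ℕ) (C : Fin K → ℕ) : EReal :=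
  ∑ k, U k (partitionHitRate b lam F n (C k) k)

/-- The optimal sum of utilities over all partitions of a cache of size `C`. -/
def optPartitionUtility (b : Fin K → ℕ) (lam : Fin K → ℝ) (F : Fin K → ℝ → ℝ)
    (U : Fin K → ℝ → EReal) (n C : ℕ) : EReal :=
  ⨆ c ∈ {c : Fin K → ℕ | ∑ k, c k ≤ C}, partitionUtility b lam F U n c

/-! ### Asymptotic quantities -/

/-- The fraction of the files that is cached at the normalized characteristic time `τ`. -/
def occupancy (F : ℝ → ℝ) (τ : ℝ) : ℝ := ∫ x in (0 : ℝ)..1, (1 - Real.exp (-(deriv F x * τ)))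

/-- The miss probability at the normalized characteristic time `τ`. -/
def missAt (F : ℝ → ℝ) (τ : ℝ) : ℝ := ∫ x in (0 : ℝ)..1, deriv F x * Real.exp (-(deriv F x * τ))

open Classical in
/-- The asymptotic miss probability `μ(β)` of a cache for the fraction `β ≥ 0` of the files:
`missAt F τ` for the characteristic time `τ` with `occupancy F τ = β`. If `β` is too large for any
finite `τ`, all files that are ever requested fit (`τ = ∞`) and the miss probability is `0`. -/
def asympMiss (F : ℝ → ℝ) (β : ℝ) : ℝ :=
  if h : ∃ τ, 0 ≤ τ ∧ occupancy F τ = β then missAt F h.choose else 0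

/-- The fraction of all files that is in the shared cache at characteristic time `τ`. -/
def sharedOccupancy (b : Fin K → ℕ) (lam : Fin K → ℝ) (F : Fin K → ℝ → ℝ) (τ : ℝ) : ℝ :=
  1 - ∑ k, (b k : ℝ) / total b *
    ∫ x in (0 : ℝ)..1, Real.exp (-(share lam k * deriv (F k) x * τ * total b / b k))

/-- The miss probability of provider `k` in the shared cache at characteristic time `τ`. -/
def sharedMissAt (b : Fin K → ℕ) (lam : Fin K → ℝ) (F : Fin K → ℝ → ℝ) (τ : ℝ) (k : Fin K) : ℝ :=
  ∫ x in (0 : ℝ)..1,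
    deriv (F k) x * Real.exp (-(share lam k * deriv (F k) x * τ * total b / b k))

open Classical in
/-- The asymptotic miss probability of provider `k` in a shared cache for the fraction `β ≥ 0` of
all files; as in `asympMiss`, it is `0` if no finite characteristic time exists. -/
def asympSharedMiss (b : Fin K → ℕ) (lam : Fin K → ℝ) (F : Fin K → ℝ → ℝ) (β : ℝ) (k : Fin K) :
    ℝ :=
  if h : ∃ τ, 0 ≤ τ ∧ sharedOccupancy b lam F τ = β then sharedMissAt b lam F h.choose k else 0

/-- The asymptotic sum of utilities `U^(s)` for the shared cache. -/
def asympSharedUtility (b : Fin K → ℕ) (lam : Fin K → ℝ) (F : Fin K → ℝ → ℝ)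
    (U : Fin K → ℝ → EReal) (β : ℝ) : EReal :=
  ∑ k, U k (lam k * (1 - asympSharedMiss b lam F β k))

/-- The asymptotic sum of utilities `U^(p)` when the partition of provider `k` can hold the
fraction `βs k` of its files. -/
def asympPartitionUtility (lam : Fin K → ℝ) (F : Fin K → ℝ → ℝ)
    (U : Fin K → ℝ → EReal) (βs : Fin K → ℝ) : EReal :=
  ∑ k, U k (lam k * (1 - asympMiss (F k) (βs k)))

/-- The feasible partitions: `βs k ≥ 0` and `∑ k, (b_k / B) βs k = β`. -/
def feasible (b : Fin K → ℕ) (β : ℝ) : Set (Fin K → ℝ) :=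
  {βs | (∀ k, 0 ≤ βs k) ∧ ∑ k, (b k : ℝ) / total b * βs k = β}

end LRUCache

end

/-! An LRU cache of capacity `C` holds the `C` most recently requested distinct files. So, for any
`t`, a file occurring among the last `t` requests is cached if these contain at most `C` distinct
files, and a file not occurring there is absent if they contain at least `C`. The number of files
unseen in `t` requests has variance at most the number `N` of files, so by Chebyshev deviations of
order `N` have vanishing probability. If the expected number of distinct files is below (above) `C`
by a fixed fraction of `N`, file `i` is therefore cached with probability at least (at most) `1 - (1
- q i) ^ t`, up to `o(1)`: see `cachedProb_ge` and `cachedProb_le`.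

For `t` about `τ N`, sums over files are integrals of step densities converging to `F'`, and
dominated convergence gives the occupancy and miss integrals (`tendsto_unseen`, `tendsto_miss`).
Letting `τ` approach the characteristic time from both sides closes the gap, since occupancy is
strictly increasing and the miss probability continuous in `τ`. If there is no characteristic time,
every `τ` may be used in the lower bound, and the miss probability vanishes as `τ → ∞`.

The shared cache at time `τ₀` treats provider `k` exactly as a private cache at time `timeScale b
lam k * τ₀`. Giving each provider the fraction of its files cached at that time is feasible and
reproduces all miss probabilities (`exists_feasible_asympMiss_eq`), so partitioning loses nothing,
whatever the utilities. Concavity matters only for continuity of the utilities on `(0, ∞)`. -/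

namespace LRUCache

/-! ### Expectations over finite request sequences. -/

section Expectation

variable {ι : Type*} [Fintype ι]

/-- The expectation of `f` at the list of `t` independent requests with law `q`. -/
noncomputable def requestExp (q : ι → ℝ) : ℕ → (List ι → ℝ) → ℝ
  | 0, f => f []
  | t + 1, f => ∑ x, q x * requestExp q t (fun l => f (x :: l))

/-- Links two views: the weighted sum gives linearity and monotonicity, the recursion on the first
request gives exact values by induction. -/
theorem sum_prod_mul_eq_requestExp (q : ι → ℝ) (t : ℕ) (f : List ι → ℝ) :
    ∑ w : Fin t → ι, (∏ s, q (w s)) * f (List.ofFn w) = requestExp q t f := by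
  induction t generalizing f with
  | zero => simp [requestExp]
  | succ t ih =>
    rw [← (Fin.consEquiv fun _ : Fin (t + 1) => ι).sum_comp, Fintype.sum_prod_type]
    simp only [requestExp, Fin.consEquiv_apply, Fin.prod_univ_succ, Fin.cons_zero, Fin.cons_succ,
        List.ofFn_succ]
    refine Finset.sum_congr rfl fun x _ => ?_
    rw [← ih, Finset.mul_sum]
    exact Finset.sum_congr rfl fun w _ => mul_assoc _ _ _

theorem requestExp_add (q : ι → ℝ) (t : ℕ) (f g : List ι → ℝ) :
    requestExp q t (fun l => f l + g l) = requestExp q t f + requestExp q t g := by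
  simp only [← sum_prod_mul_eq_requestExp, ← Finset.sum_add_distrib, mul_add]

theorem requestExp_const_mul (q : ι → ℝ) (t : ℕ) (c : ℝ) (f : List ι → ℝ) :
    requestExp q t (fun l => c * f l) = c * requestExp q t f := by
  simp only [← sum_prod_mul_eq_requestExp, Finset.mul_sum]
  exact Finset.sum_congr rfl fun w _ => by ring

theorem requestExp_sum {κ : Type*} (q : ι → ℝ) (t : ℕ) (s : Finset κ) (f : κ → List ι → ℝ) :
    requestExp q t (fun l => ∑ j ∈ s, f j l) = ∑ j ∈ s, requestExp q t (f j) := by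
  simp only [← sum_prod_mul_eq_requestExp, Finset.mul_sum]
  exact Finset.sum_comm

theorem requestExp_const {q : ι → ℝ} (hq1 : ∑ j, q j = 1) (t : ℕ) (c : ℝ) :
    requestExp q t (fun _ => c) = c := by
  induction t with
  | zero => rfl
  | succ t ih => simp only [requestExp, ih, ← Finset.sum_mul, hq1, one_mul]

theorem requestExp_mono {q : ι → ℝ} (hq : ∀ j, 0 ≤ q j) (t : ℕ) {f g : List ι → ℝ}
    (h : ∀ l, l.length = t → f l ≤ g l) : requestExp q t f ≤ requestExp q t g := by
  simp only [← sum_prod_mul_eq_requestExp]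
  exact Finset.sum_le_sum fun w _ => mul_le_mul_of_nonneg_left (h _ (by simp))
    (Finset.prod_nonneg fun s _ => hq _)

/-- Lists are chronological, so `drop` forgets the oldest requests: the last `t` of many requests
have the law of `t` requests. -/
theorem requestExp_drop {q : ι → ℝ} (hq1 : ∑ j, q j = 1) (r t : ℕ) (f : List ι → ℝ) :
    requestExp q (t + r) (fun l => f (l.drop r)) = requestExp q t f := by
  induction r with
  | zero => simp
  | succ r ih =>
    rw [← Nat.add_assoc]
    simp only [requestExp, List.drop_succ_cons, ih, ← Finset.sum_mul, hq1, one_mul]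

end Expectation

/-! ### LRU contents and Chebyshev bounds for a finite catalogue. -/

section Finite

variable {ι : Type*} [DecidableEq ι]

theorem content_append_singleton (C : ℕ) (l : List ι) (x : ι) :
    content C (l ++ [x]) = step C (content C l) x := by
  simp [content]

theorem content_subset (C : ℕ) (l : List ι) : content C l ⊆ l := by
  induction l using List.reverseRecOn with
  | nil => simp [content]
  | append_singleton l x ih =>
    rw [content_append_singleton]
    intro y hy
    have hy' := List.mem_of_mem_take hy
    rcases List.mem_cons.1 hy' with rfl | h
    · simp
    · exact List.mem_append_left _ (ih (List.mem_of_mem_erase h))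

theorem content_nodup (C : ℕ) (l : List ι) : (content C l).Nodup := by
  induction l using List.reverseRecOn with
  | nil => simp [content]
  | append_singleton l x ih =>
    rw [content_append_singleton]
    refine List.Nodup.sublist (List.take_sublist _ _) ?_
    rw [List.nodup_cons]
    exact ⟨fun h => (ih.mem_erase_iff.1 h).1 rfl, ih.erase x⟩

theorem content_length (C : ℕ) (l : List ι) :
    (content C l).length = min C l.toFinset.card := by
  induction l using List.reverseRecOn with
  | nil => simp [content]
  | append_singleton l x ih =>
    rw [content_append_singleton, step, List.length_take, List.length_cons]
    have hsub : (content C l).toFinset ⊆ l.toFinset := fun y hy =>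
      List.mem_toFinset.2 (content_subset C l (List.mem_toFinset.1 hy))
    have hcard := List.toFinset_card_of_nodup (content_nodup C l)
    have hset : (l ++ [x]).toFinset = insert x l.toFinset := by
      ext y; simp
    rw [hset]
    by_cases hx : x ∈ content C l
    · have hpos : 0 < (content C l).length := List.length_pos_of_mem hx
      rw [List.length_erase_of_mem hx,
        Finset.insert_eq_of_mem (List.mem_toFinset.2 (content_subset C l hx))]
      omega
    · rw [List.erase_of_not_mem hx]
      by_cases hl : x ∈ l
      · rw [Finset.insert_eq_of_mem (List.mem_toFinset.2 hl)]
        -- A requested file that is no longer cached shows that the cache is full.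
        have hlt : (content C l).toFinset.card < l.toFinset.card :=
          Finset.card_lt_card (hsub.ssubset_of_mem_notMem (List.mem_toFinset.2 hl)
            (fun h => hx (List.mem_toFinset.1 h)))
        omega
      · rw [Finset.card_insert_of_notMem (fun h => hl (List.mem_toFinset.1 h))]
        omega

/-- Older requests can only add files at the tail: the empty cache is a prefix of any content, and
each request preserves prefixes. -/
theorem content_prefix_append (C : ℕ) (l' l : List ι) :
    content C l <+: content C (l' ++ l) := by
  unfold content
  rw [List.foldl_append]
  exact foldl_step_prefix C l List.nil_prefix

/-- As long as at most `C` distinct files have been requested, they are all in the cache. -/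
theorem mem_content_of_card_le {C : ℕ} {l : List ι} (h : l.toFinset.card ≤ C) {i : ι}
    (hi : i ∈ l) : i ∈ content C l := by
  have hsub : (content C l).toFinset ⊆ l.toFinset := fun y hy =>
    List.mem_toFinset.2 (content_subset C l (List.mem_toFinset.1 hy))
  have heq := Finset.eq_of_subset_of_card_le hsub (by
    rw [List.toFinset_card_of_nodup (content_nodup C l), content_length, min_eq_right h])
  rw [← List.mem_toFinset, heq]
  exact List.mem_toFinset.2 hi

/-- If the most recent requests `l` are for at least `C` distinct files, all other files are
evicted. -/
theorem mem_of_mem_content_append {C : ℕ} {l' l : List ι} (h : C ≤ l.toFinset.card) {i : ι}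
    (hi : i ∈ content C (l' ++ l)) : i ∈ l := by
  have heq := (content_prefix_append C l' l).eq_of_length_le (by
    rw [content_length, content_length, min_eq_left h]; exact min_le_left _ _)
  rw [← heq] at hi
  exact content_subset C l hi

variable [Fintype ι]

theorem cachedProbAfter_eq_requestExp (C : ℕ) (q : ι → ℝ) (t : ℕ) (i : ι) :
    cachedProbAfter C q t i = requestExp q t (fun l => if i ∈ content C l then 1 else 0) :=
  sum_prod_mul_eq_requestExp q t (fun l => if i ∈ content C l then 1 else 0)

theorem requestExp_notMem {q : ι → ℝ} (hq1 : ∑ j, q j = 1) (t : ℕ) (i : ι) :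
    requestExp q t (fun l => if i ∈ l then 0 else 1) = (1 - q i) ^ t := by
  induction t with
  | zero => simp [requestExp]
  | succ t ih =>
    have h : ∀ x, q x * requestExp q t (fun l => if i ∈ x :: l then 0 else 1) =
        (q x - if x = i then q i else 0) * (1 - q i) ^ t := by
      intro x
      by_cases hx : x = i
      · subst hx
        simp [requestExp_const hq1]
      · simp [hx, Ne.symm hx, ih]
    simp only [requestExp, h, ← Finset.sum_mul, Finset.sum_sub_distrib, hq1]
    simp [pow_succ']

theorem requestExp_notMem_mul_notMem {q : ι → ℝ} (hq1 : ∑ j, q j = 1) (t : ℕ) {i j : ι}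
    (hij : i ≠ j) :
    requestExp q t (fun l => (if i ∈ l then 0 else 1) * (if j ∈ l then 0 else 1)) =
      (1 - q i - q j) ^ t := by
  induction t with
  | zero => simp [requestExp]
  | succ t ih =>
    have h : ∀ x, q x * requestExp q t
        (fun l => (if i ∈ x :: l then 0 else 1) * (if j ∈ x :: l then 0 else 1)) =
        (q x - (if x = i then q i else 0) - (if x = j then q j else 0)) *
          (1 - q i - q j) ^ t := by
      intro x
      by_cases hx : x = i
      · subst hx
        simp [requestExp_const hq1, hij]
      · by_cases hy : x = j
        · subst hy
          simp [requestExp_const hq1, hx]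
        · simp only [List.mem_cons, Ne.symm hx, Ne.symm hy, false_or, ih, hx, hy, if_false,
            sub_zero]
    simp only [requestExp, h, ← Finset.sum_mul, Finset.sum_sub_distrib, hq1]
    simp [pow_succ']

/-- The expected number of files that are not among `t` requests. -/
noncomputable def expUnseen (q : ι → ℝ) (t : ℕ) : ℝ := ∑ i, (1 - q i) ^ t

theorem sum_notMem_eq (l : List ι) :
    ∑ i, (if i ∈ l then (0 : ℝ) else 1) = Fintype.card ι - l.toFinset.card := by
  have h : ∀ i, (if i ∈ l then (0 : ℝ) else 1) = 1 - if i ∈ l.toFinset then 1 else 0 := by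
    intro i; by_cases hi : i ∈ l <;> simp [hi]
  simp only [h, Finset.sum_sub_distrib, Finset.sum_ite_mem, Finset.univ_inter]
  simp

/-- The variance of the number of files that are not among `t` requests is at most the number of
files, since the indicators are negatively correlated. -/
theorem requestExp_unseen_sq_le {q : ι → ℝ} (hq : ∀ j, 0 ≤ q j) (hq1 : ∑ j, q j = 1) (t : ℕ) :
    requestExp q t (fun l => (∑ i, (if i ∈ l then (0 : ℝ) else 1) - expUnseen q t) ^ 2) ≤
      Fintype.card ι := by
  have hle1 : ∀ i, q i ≤ 1 := fun i => by
    rw [← hq1]; exact Finset.single_le_sum (fun j _ => hq j) (Finset.mem_univ i)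
  have hle2 : ∀ i j, i ≠ j → q i + q j ≤ 1 := fun i j hij => by
    rw [← hq1, ← Finset.sum_pair hij]
    exact Finset.sum_le_sum_of_subset_of_nonneg (Finset.subset_univ _) fun k _ _ => hq k
  have hexp : ∀ l : List ι, (∑ i, (if i ∈ l then (0 : ℝ) else 1) - expUnseen q t) ^ 2 =
      ∑ i, ∑ j, ((if i ∈ l then (0 : ℝ) else 1) * (if j ∈ l then (0 : ℝ) else 1) +
        (-(1 - q i) ^ t) * (if j ∈ l then (0 : ℝ) else 1) +
        (-(1 - q j) ^ t) * (if i ∈ l then (0 : ℝ) else 1) + (1 - q i) ^ t * (1 - q j) ^ t) := by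
    intro l
    rw [expUnseen, ← Finset.sum_sub_distrib, sq, Finset.sum_mul_sum]
    exact Finset.sum_congr rfl fun i _ => Finset.sum_congr rfl fun j _ => by ring
  simp only [hexp, requestExp_sum, requestExp_add, requestExp_const_mul, requestExp_const hq1,
    requestExp_notMem hq1]
  -- Diagonal terms are variances of indicators, at most `1`; the others are covariances,
  -- nonpositive because `1 - q i - q j ≤ (1 - q i) * (1 - q j)`.
  calc _ ≤ ∑ i : ι, ∑ j : ι, (if i = j then (1 : ℝ) else 0) := by
        refine Finset.sum_le_sum fun i _ => Finset.sum_le_sum fun j _ => ?_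
        split_ifs with hij
        · subst hij
          have h : ∀ l : List ι, (if i ∈ l then (0 : ℝ) else 1) * (if i ∈ l then (0 : ℝ) else 1) =
              if i ∈ l then (0 : ℝ) else 1 := fun l => by split_ifs <;> simp
          simp only [h, requestExp_notMem hq1]
          have h1 : (1 - q i) ^ t ≤ 1 := pow_le_one₀ (by linarith [hle1 i]) (by linarith [hq i])
          nlinarith [sq_nonneg ((1 - q i) ^ t)]
        · rw [requestExp_notMem_mul_notMem hq1 t hij]
          have h1 : (1 - q i - q j) ^ t ≤ ((1 - q i) * (1 - q j)) ^ t :=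
            pow_le_pow_left₀ (by linarith [hle2 i j hij])
              (by nlinarith [mul_nonneg (hq i) (hq j)]) t
          rw [mul_pow] at h1
          nlinarith
    _ = Fintype.card ι := by simp

/-- Chebyshev's inequality for the number of unseen files. -/
theorem requestExp_indicator_le {q : ι → ℝ} (hq : ∀ j, 0 ≤ q j) (hq1 : ∑ j, q j = 1) (t : ℕ)
    {δ : ℝ} (hδ : 0 < δ) (P : List ι → Prop) [DecidablePred P]
    (hP : ∀ l, P l → δ ≤ |(Fintype.card ι - l.toFinset.card : ℝ) - expUnseen q t|) :
    requestExp q t (fun l => if P l then 1 else 0) ≤ Fintype.card ι / δ ^ 2 := by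
  rw [le_div_iff₀ (by positivity), mul_comm, ← requestExp_const_mul]
  refine (requestExp_mono hq t fun l _ => ?_).trans (requestExp_unseen_sq_le hq hq1 t)
  rw [sum_notMem_eq]
  split_ifs with h
  · rw [mul_one, ← sq_abs (_ - expUnseen q t)]
    exact pow_le_pow_left₀ hδ.le (hP l h) 2
  · rw [mul_zero]; positivity

/-- File `i` is missing after `t` requests only if it was not requested or more than `C` distinct
files were. The probability of being cached increases with time, so a bound at time `t` passes to
the limit. -/
theorem cachedProb_ge {q : ι → ℝ} (hq : ∀ j, 0 ≤ q j) (hq1 : ∑ j, q j = 1) (C t : ℕ)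
    {δ : ℝ} (hδ : 0 < δ) (h : Fintype.card ι - expUnseen q t + δ ≤ C) (i : ι) :
    1 - (1 - q i) ^ t - Fintype.card ι / δ ^ 2 ≤ cachedProb C q i := by
  have hmono := monotone_nat_of_le_succ (cachedProbAfter_le_succ C hq hq1 i)
  refine le_trans ?_ (hmono.ge_of_tendsto (tendsto_cachedProb C hq hq1 i) t)
  have hcheb := requestExp_indicator_le hq hq1 t hδ (fun l => C < l.toFinset.card) fun l hl => by
    have : (C : ℝ) < l.toFinset.card := by exact_mod_cast hl
    rw [abs_sub_comm]
    exact le_trans (by linarith) (le_abs_self _)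
  have hle : requestExp q t (fun _ => 1) ≤
      requestExp q t (fun l => (if i ∈ l then 0 else 1) + ((if i ∈ content C l then 1 else 0) +
        (if C < l.toFinset.card then 1 else 0))) := by
    refine requestExp_mono hq t fun l _ => ?_
    by_cases h1 : i ∈ l
    · by_cases h2 : C < l.toFinset.card
      · simp only [h1, h2, if_true]; split_ifs <;> norm_num
      · simp [h1, h2, mem_content_of_card_le (not_lt.1 h2) h1]
    · simp only [h1, if_false]; split_ifs <;> norm_num
  rw [requestExp_const hq1, requestExp_add, requestExp_add, requestExp_notMem hq1,
    ← cachedProbAfter_eq_requestExp] at hle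
  linarith

/-- After `t + r` requests, file `i` is cached only if it is among the last `t` or these contain
fewer than `C` distinct files. The bound is free of `r`, which tends to infinity. -/
theorem cachedProb_le {q : ι → ℝ} (hq : ∀ j, 0 ≤ q j) (hq1 : ∑ j, q j = 1) (C t : ℕ)
    {δ : ℝ} (hδ : 0 < δ) (h : C + δ ≤ Fintype.card ι - expUnseen q t) (i : ι) :
    cachedProb C q i ≤ 1 - (1 - q i) ^ t + Fintype.card ι / δ ^ 2 := by
  refine le_of_tendsto ((tendsto_add_atTop_iff_nat t).2 (tendsto_cachedProb C hq hq1 i))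
    (Eventually.of_forall fun r => ?_)
  have hcheb := requestExp_indicator_le hq hq1 t hδ (fun l => l.toFinset.card < C) fun l hl => by
    have : (l.toFinset.card : ℝ) < C := by exact_mod_cast hl
    exact le_trans (by linarith) (le_abs_self _)
  have hle : requestExp q (t + r) (fun l => (if i ∈ content C l then 1 else 0)) ≤
      requestExp q (t + r) (fun l => (fun l' => 1 + ((-1) * (if i ∈ l' then 0 else 1) +
        (if l'.toFinset.card < C then 1 else 0))) (l.drop r)) := by
    refine requestExp_mono hq _ fun l _ => ?_
    by_cases h1 : i ∈ l.drop r
    · simp only [h1, if_true]; split_ifs <;> norm_num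
    · by_cases h2 : (l.drop r).toFinset.card < C
      · simp only [h1, h2, if_true]; split_ifs <;> norm_num
      · have h3 : i ∉ content C l := fun hi => h1 (mem_of_mem_content_append (not_lt.1 h2)
          (l' := l.take r) (by rwa [List.take_append_drop]))
        simp [h1, h2, h3]
  rw [requestExp_drop hq1 r t fun l' => 1 + ((-1) * (if i ∈ l' then 0 else 1) +
      (if l'.toFinset.card < C then 1 else 0)), requestExp_add, requestExp_add, requestExp_const_mul,
    requestExp_const hq1, requestExp_notMem hq1, ← cachedProbAfter_eq_requestExp] at hle
  rw [add_comm r t]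
  linarith

theorem cachedProb_le_one {q : ι → ℝ} (hq : ∀ j, 0 ≤ q j) (hq1 : ∑ j, q j = 1) (C : ℕ) (i : ι) :
    cachedProb C q i ≤ 1 :=
  le_of_tendsto (tendsto_cachedProb C hq hq1 i)
    (Eventually.of_forall fun t => cachedProbAfter_le_one C hq hq1 i t)

theorem cachedProb_zero (q : ι → ℝ) (i : ι) : cachedProb 0 q i = 0 := by
  have h : ∀ t, cachedProbAfter 0 q t i = 0 := fun t => by
    refine Finset.sum_eq_zero fun w _ => ?_
    have : content 0 (List.ofFn w) = [] := List.eq_nil_of_length_eq_zero (by simp [content_length])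
    simp [this]
  simp only [cachedProb, h]
  exact tendsto_const_nhds.limUnder_eq

end Finite

/-- For `y < 1`, `1 - y` lies between `exp (-y / (1 - y))` and `exp (-y)`. The squeeze needs neither
`y ≠ 0` nor `s → ∞`. -/
theorem tendsto_one_sub_pow_exp {α : Type*} {l : Filter α} {y : α → ℝ} {s : α → ℕ} {z : ℝ}
    (hy : Tendsto y l (𝓝 0))
    (hsy : Tendsto (fun n => s n * y n) l (𝓝 z)) :
    Tendsto (fun n => (1 - y n) ^ s n) l (𝓝 (Real.exp (-z))) := by
  have h1 : Tendsto (fun n => Real.exp (-(s n * y n))) l (𝓝 (Real.exp (-z))) :=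
    (Real.continuous_exp.tendsto _).comp hsy.neg
  have h2 : Tendsto (fun n => Real.exp (-(s n * y n / (1 - y n)))) l (𝓝 (Real.exp (-z))) := by
    refine (Real.continuous_exp.tendsto _).comp (Tendsto.neg ?_)
    have := hsy.div (tendsto_const_nhds.sub hy) (by norm_num : (1 : ℝ) - 0 ≠ 0)
    rwa [sub_zero, div_one] at this
  refine tendsto_of_tendsto_of_tendsto_of_le_of_le' h2 h1 ?_ ?_
  · filter_upwards [hy.eventually_lt_const one_pos] with n hn
    have hpos : 0 < 1 - y n := by linarith
    rw [show -(s n * y n / (1 - y n)) = s n * (-(y n / (1 - y n))) by ring, Real.exp_nat_mul]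
    refine pow_le_pow_left₀ (Real.exp_pos _).le ?_ _
    rw [Real.exp_neg]
    refine inv_le_of_inv_le₀ hpos ?_
    calc (1 - y n)⁻¹ = y n / (1 - y n) + 1 := by field_simp; ring
      _ ≤ _ := Real.add_one_le_exp _
  · filter_upwards [hy.eventually_lt_const one_pos] with n hn
    rw [show -(s n * y n) = s n * (-y n) by ring, Real.exp_nat_mul]
    exact pow_le_pow_left₀ (by linarith) (Real.one_sub_le_exp_neg _) _

/-! ### From finite bounds to limits of hit probabilities. -/

section HitProbability

variable {ι κ : ℕ → Type*} [∀ n, Fintype (ι n)] [∀ n, DecidableEq (ι n)] [∀ n, Fintype (κ n)]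
  {q : ∀ n, ι n → ℝ} {p : ∀ n, κ n → ℝ} {e : ∀ n, κ n → ι n} {C : ℕ → ℕ} {β : ℝ} {G M : ℝ → ℝ}

/-- Here `q` is the law of all requests to the cache and `p` averages over the files `e n j` of one
provider, which covers shared and private caches alike. With `d` half the gap `β - g`, the choice `δ
= d * N` makes the Chebyshev error `1 / (d ^ 2 * N)`. -/
theorem eventually_hitProb_ge (hq : ∀ᶠ n in atTop, (∀ j, 0 ≤ q n j) ∧ ∑ j, q n j = 1)
    (hp : ∀ᶠ n in atTop, (∀ j, 0 ≤ p n j) ∧ ∑ j, p n j = 1)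
    (hN : Tendsto (fun n => (Fintype.card (ι n) : ℝ)) atTop atTop)
    (hC : Tendsto (fun n => (C n : ℝ) / Fintype.card (ι n)) atTop (𝓝 β)) {t : ℕ → ℕ} {g m ε : ℝ}
    (hG : Tendsto (fun n => expUnseen (q n) (t n) / Fintype.card (ι n)) atTop (𝓝 (1 - g)))
    (hM : Tendsto (fun n => ∑ j, p n j * (1 - q n (e n j)) ^ t n) atTop (𝓝 m))
    (hg : g < β) (hε : 0 < ε) :
    ∀ᶠ n in atTop, 1 - m - ε ≤ ∑ j, p n j * cachedProb (C n) (q n) (e n j) := by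
  set d := (β - g) / 2 with hd
  have hd0 : 0 < d := by rw [hd]; linarith
  have h1 : ∀ᶠ n in atTop, 1 - expUnseen (q n) (t n) / Fintype.card (ι n) + d <
      (C n : ℝ) / Fintype.card (ι n) :=
    ((tendsto_const_nhds.sub hG).add tendsto_const_nhds).eventually_lt hC (by linarith)
  have h2 : Tendsto (fun n => ∑ j, p n j * (1 - q n (e n j)) ^ t n +
      1 / (d ^ 2 * Fintype.card (ι n))) atTop (𝓝 (m + 0)) :=
    hM.add (tendsto_const_nhds.div_atTop (hN.const_mul_atTop (by positivity)))
  filter_upwards [hq, hp, hN.eventually_gt_atTop 0, h1,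
    h2.eventually_lt_const (by linarith : m + 0 < m + ε)] with n ⟨hq, hq1⟩ ⟨hp, hp1⟩ hn h1 h2
  set N : ℝ := (Fintype.card (ι n) : ℝ)
  have hδ : N - expUnseen (q n) (t n) + d * N ≤ C n := by
    have := mul_lt_mul_of_pos_right h1 hn
    rw [add_mul, sub_mul, div_mul_cancel₀ _ hn.ne', div_mul_cancel₀ _ hn.ne'] at this
    linarith
  have hNd : N / (d * N) ^ 2 = 1 / (d ^ 2 * N) := by field_simp
  have hge : ∑ j, p n j * (1 - (1 - q n (e n j)) ^ t n - N / (d * N) ^ 2) ≤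
      ∑ j, p n j * cachedProb (C n) (q n) (e n j) :=
    Finset.sum_le_sum fun j _ => mul_le_mul_of_nonneg_left
      (cachedProb_ge hq hq1 (C n) (t n) (by positivity) hδ _) (hp j)
  simp only [mul_sub, mul_one, Finset.sum_sub_distrib, ← Finset.sum_mul, hp1, hNd] at hge
  linarith

theorem eventually_hitProb_le (hq : ∀ᶠ n in atTop, (∀ j, 0 ≤ q n j) ∧ ∑ j, q n j = 1)
    (hp : ∀ᶠ n in atTop, (∀ j, 0 ≤ p n j) ∧ ∑ j, p n j = 1)
    (hN : Tendsto (fun n => (Fintype.card (ι n) : ℝ)) atTop atTop)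
    (hC : Tendsto (fun n => (C n : ℝ) / Fintype.card (ι n)) atTop (𝓝 β)) {t : ℕ → ℕ} {g m ε : ℝ}
    (hG : Tendsto (fun n => expUnseen (q n) (t n) / Fintype.card (ι n)) atTop (𝓝 (1 - g)))
    (hM : Tendsto (fun n => ∑ j, p n j * (1 - q n (e n j)) ^ t n) atTop (𝓝 m))
    (hg : β < g) (hε : 0 < ε) :
    ∀ᶠ n in atTop, ∑ j, p n j * cachedProb (C n) (q n) (e n j) ≤ 1 - m + ε := by
  set d := (g - β) / 2 with hd
  have hd0 : 0 < d := by rw [hd]; linarith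
  have h1 : ∀ᶠ n in atTop, (C n : ℝ) / Fintype.card (ι n) + d <
      1 - expUnseen (q n) (t n) / Fintype.card (ι n) :=
    (hC.add tendsto_const_nhds).eventually_lt (tendsto_const_nhds.sub hG) (by linarith)
  have h2 : Tendsto (fun n => ∑ j, p n j * (1 - q n (e n j)) ^ t n -
      1 / (d ^ 2 * Fintype.card (ι n))) atTop (𝓝 (m - 0)) :=
    hM.sub (tendsto_const_nhds.div_atTop (hN.const_mul_atTop (by positivity)))
  filter_upwards [hq, hp, hN.eventually_gt_atTop 0, h1,
    h2.eventually_const_lt (by linarith : m - ε < m - 0)] with n ⟨hq, hq1⟩ ⟨hp, hp1⟩ hn h1 h2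
  set N : ℝ := (Fintype.card (ι n) : ℝ)
  have hδ : C n + d * N ≤ N - expUnseen (q n) (t n) := by
    have := mul_lt_mul_of_pos_right h1 hn
    rw [add_mul, sub_mul, div_mul_cancel₀ _ hn.ne', div_mul_cancel₀ _ hn.ne'] at this
    linarith
  have hNd : N / (d * N) ^ 2 = 1 / (d ^ 2 * N) := by field_simp
  have hge : ∑ j, p n j * cachedProb (C n) (q n) (e n j) ≤
      ∑ j, p n j * (1 - (1 - q n (e n j)) ^ t n + N / (d * N) ^ 2) :=
    Finset.sum_le_sum fun j _ => mul_le_mul_of_nonneg_left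
      (cachedProb_le hq hq1 (C n) (t n) (by positivity) hδ _) (hp j)
  simp only [mul_add, mul_sub, mul_one, Finset.sum_sub_distrib, Finset.sum_add_distrib,
    ← Finset.sum_mul, hp1, hNd] at hge
  linarith

/-- Convergence of the hit probability when the characteristic time `τ₀` is finite. -/
theorem tendsto_hitProb (hq : ∀ᶠ n in atTop, (∀ j, 0 ≤ q n j) ∧ ∑ j, q n j = 1)
    (hp : ∀ᶠ n in atTop, (∀ j, 0 ≤ p n j) ∧ ∑ j, p n j = 1)
    (hN : Tendsto (fun n => (Fintype.card (ι n) : ℝ)) atTop atTop)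
    (hC : Tendsto (fun n => (C n : ℝ) / Fintype.card (ι n)) atTop (𝓝 β)) {t : ℝ → ℕ → ℕ}
    (hG : ∀ τ, 0 < τ →
      Tendsto (fun n => expUnseen (q n) (t τ n) / Fintype.card (ι n)) atTop (𝓝 (1 - G τ)))
    (hM : ∀ τ, 0 < τ →
      Tendsto (fun n => ∑ j, p n j * (1 - q n (e n j)) ^ t τ n) atTop (𝓝 (M τ)))
    {τ₀ : ℝ} (hτ₀ : 0 < τ₀) (hmono : StrictMonoOn G (Ici 0)) (hβ : G τ₀ = β)
    (hcont : ContinuousAt M τ₀) :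
    Tendsto (fun n => ∑ j, p n j * cachedProb (C n) (q n) (e n j)) atTop (𝓝 (1 - M τ₀)) := by
  rw [tendsto_order]
  constructor
  · intro a ha
    -- Just before `τ₀` the occupancy is strictly below `β`, while `M` has hardly changed.
    have hev : ∀ᶠ τ in 𝓝[<] τ₀, a < 1 - M τ :=
      (tendsto_const_nhds.sub hcont.tendsto).mono_left nhdsWithin_le_nhds |>.eventually_const_lt ha
    obtain ⟨τ, h1, h2, h3⟩ := (hev.and (Ioo_mem_nhdsLT hτ₀)).exists
    have := eventually_hitProb_ge (e := e) hq hp hN hC (hG τ h2) (hM τ h2)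
      (by rw [← hβ]; exact hmono h2.le hτ₀.le h3) (half_pos (sub_pos.2 h1))
    filter_upwards [this] with n hn
    linarith
  · intro a ha
    have hev : ∀ᶠ τ in 𝓝[>] τ₀, 1 - M τ < a :=
      (tendsto_const_nhds.sub hcont.tendsto).mono_left nhdsWithin_le_nhds |>.eventually_lt_const ha
    obtain ⟨τ, h1, h2⟩ := (hev.and self_mem_nhdsWithin).exists
    have h2' : 0 < τ := hτ₀.trans h2
    have := eventually_hitProb_le (e := e) hq hp hN hC (hG τ h2') (hM τ h2')
      (by rw [← hβ]; exact hmono hτ₀.le h2'.le h2) (half_pos (sub_pos.2 h1))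
    filter_upwards [this] with n hn
    linarith

/-- The hit probability tends to one when the characteristic time is infinite. -/
theorem tendsto_hitProb_one (hq : ∀ᶠ n in atTop, (∀ j, 0 ≤ q n j) ∧ ∑ j, q n j = 1)
    (hp : ∀ᶠ n in atTop, (∀ j, 0 ≤ p n j) ∧ ∑ j, p n j = 1)
    (hN : Tendsto (fun n => (Fintype.card (ι n) : ℝ)) atTop atTop)
    (hC : Tendsto (fun n => (C n : ℝ) / Fintype.card (ι n)) atTop (𝓝 β)) {t : ℝ → ℕ → ℕ}
    (hG : ∀ τ, 0 < τ →
      Tendsto (fun n => expUnseen (q n) (t τ n) / Fintype.card (ι n)) atTop (𝓝 (1 - G τ)))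
    (hM : ∀ τ, 0 < τ →
      Tendsto (fun n => ∑ j, p n j * (1 - q n (e n j)) ^ t τ n) atTop (𝓝 (M τ)))
    (hβ : ∀ τ, 0 < τ → G τ < β) (hlim : Tendsto M atTop (𝓝 0)) :
    Tendsto (fun n => ∑ j, p n j * cachedProb (C n) (q n) (e n j)) atTop (𝓝 1) := by
  rw [tendsto_order]
  constructor
  · intro a ha
    -- No `τ` fills the cache, so `τ` may be taken so large that `M τ` is negligible.
    obtain ⟨τ, h1, h2⟩ := ((hlim.eventually_lt_const (by linarith : (0 : ℝ) < 1 - a)).and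
      (eventually_gt_atTop 0)).exists
    have := eventually_hitProb_ge (e := e) hq hp hN hC (hG τ h2) (hM τ h2) (hβ τ h2)
      (ε := (1 - a - M τ) / 2) (by linarith)
    filter_upwards [this] with n hn
    linarith
  · intro a ha
    filter_upwards [hq, hp] with n ⟨hq, hq1⟩ ⟨hp, hp1⟩
    refine lt_of_le_of_lt ?_ ha
    rw [← hp1]
    exact Finset.sum_le_sum fun j _ =>
      mul_le_of_le_one_right (hp j) (cachedProb_le_one hq hq1 _ _)

end HitProbability

/-! ### Popularities as step densities, and their limits. -/

section Density

variable {F : ℝ → ℝ}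

/-- The step function with the value `m * popularity F m i` on `[i / m, (i + 1) / m)`. -/
noncomputable def stepDensity (F : ℝ → ℝ) (m : ℕ) (x : ℝ) : ℝ :=
  m * (F (((⌊m * x⌋₊ : ℕ) + 1 : ℝ) / m) - F (((⌊m * x⌋₊ : ℕ) : ℝ) / m))

theorem stepDensity_eq {m : ℕ} (i : Fin m) {x : ℝ}
    (hx : x ∈ Ico ((i : ℝ) / m) (((i : ℝ) + 1) / m)) :
    stepDensity F m x = m * popularity F m i := by
  have hm : (0 : ℝ) < m := by exact_mod_cast i.pos
  have hfl : ⌊m * x⌋₊ = i := by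
    rw [Nat.floor_eq_iff (mul_nonneg hm.le (le_trans (by positivity) hx.1))]
    exact ⟨by rw [mul_comm]; exact (div_le_iff₀ hm).1 hx.1,
      by rw [mul_comm]; exact (lt_div_iff₀ hm).1 hx.2⟩
  rw [stepDensity, hfl, popularity]

theorem measurable_stepDensity (F : ℝ → ℝ) (m : ℕ) : Measurable (stepDensity F m) :=
  (measurable_from_nat
    (f := fun j : ℕ => (m : ℝ) * (F (((j : ℕ) + 1 : ℝ) / m) - F ((j : ℝ) / m)))).comp
    (Nat.measurable_floor.comp (measurable_const.mul measurable_id))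

/-- Moves sums over a growing index set to integrals over a fixed interval, where dominated
convergence applies. -/
theorem sum_popularity_eq_integral {m : ℕ} (hm : 0 < m) (φ : ℝ → ℝ) :
    ∑ i : Fin m, φ (m * popularity F m i) = m * ∫ x in (0 : ℝ)..1, φ (stepDensity F m x) := by
  have hm' : (0 : ℝ) < m := by exact_mod_cast hm
  have heq : ∀ i : Fin m, EqOn (fun x => φ (stepDensity F m x))
      (fun _ => φ (m * popularity F m i)) (Ioo ((i : ℝ) / m) (((i : ℝ) + 1) / m)) :=
    fun i x hx => by simp only [stepDensity_eq i ⟨hx.1.le, hx.2⟩]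
  have hle : ∀ i : ℕ, (i : ℝ) / m ≤ ((i : ℝ) + 1) / m := fun i => by gcongr; linarith
  have hint : ∀ k < m, IntervalIntegrable (fun x => φ (stepDensity F m x)) MeasureTheory.volume
      ((fun j : ℕ => (j : ℝ) / m) k) ((fun j : ℕ => (j : ℝ) / m) (k + 1)) := by
    intro k hk
    have h := heq ⟨k, hk⟩
    simp only [Nat.cast_add, Nat.cast_one]
    rw [intervalIntegrable_iff_integrableOn_Ioo_of_le (hle k)]
    exact (MeasureTheory.integrableOn_congr_fun h measurableSet_Ioo).2
      (MeasureTheory.integrableOn_const (by simp))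
  have hsum := intervalIntegral.sum_integral_adjacent_intervals hint
  simp only [Nat.cast_zero, zero_div, div_self hm'.ne'] at hsum
  rw [← hsum, Finset.mul_sum, ← Fin.sum_univ_eq_sum_range
    (fun k => (m : ℝ) * ∫ x in (k : ℝ) / m..((k + 1 : ℕ) : ℝ) / m, φ (stepDensity F m x))]
  refine Finset.sum_congr rfl fun i _ => ?_
  push_cast
  rw [intervalIntegral.integral_congr_Ioo_of_le (hle i) (heq i), intervalIntegral.integral_const,
    smul_eq_mul]
  field_simp
  ring

theorem sum_popularity (hF : IsPopularity F) {m : ℕ} (hm : 0 < m) :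
    ∑ i, popularity F m i = 1 := by
  have hm' : (m : ℝ) ≠ 0 := by exact_mod_cast hm.ne'
  have h := Finset.sum_range_sub (fun i : ℕ => F ((i : ℝ) / m)) m
  rw [← Fin.sum_univ_eq_sum_range (fun i : ℕ => F (((i + 1 : ℕ) : ℝ) / m) - F ((i : ℝ) / m))] at h
  simpa [popularity, hm', hF.zero, hF.one] using h

theorem popularity_nonneg (hF : IsPopularity F) (m : ℕ) (i : Fin m) : 0 ≤ popularity F m i := by
  have hm : (0 : ℝ) < m := by exact_mod_cast i.pos
  have hi : (i : ℝ) + 1 ≤ m := by exact_mod_cast i.2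
  have h1 : (i : ℝ) / m ≤ ((i : ℝ) + 1) / m := by gcongr; linarith
  have h2 : ((i : ℝ) + 1) / m ≤ 1 := (div_le_one hm).2 hi
  have h3 : 0 ≤ (i : ℝ) / m := by positivity
  exact sub_nonneg.2 (hF.mono ⟨h3, h1.trans h2⟩ ⟨h3.trans h1, h2⟩ h1)

theorem popularity_le_one (hF : IsPopularity F) (m : ℕ) (i : Fin m) : popularity F m i ≤ 1 := by
  rw [← sum_popularity hF i.pos]
  exact Finset.single_le_sum (fun j _ => popularity_nonneg hF m j) (Finset.mem_univ i)

theorem stepDensity_mem (hF : IsPopularity F) {m : ℕ} (hm : 0 < m) {x : ℝ} (hx : x ∈ Ico 0 1) :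
    stepDensity F m x ∈ Icc (0 : ℝ) m := by
  have hm' : (0 : ℝ) < m := by exact_mod_cast hm
  have hx0 : 0 ≤ m * x := mul_nonneg hm'.le hx.1
  have hlt : ⌊m * x⌋₊ < m := (Nat.floor_lt hx0).2 (mul_lt_of_lt_one_right hm' hx.2)
  rw [stepDensity_eq (⟨⌊m * x⌋₊, hlt⟩ : Fin m)
    ⟨(div_le_iff₀' hm').2 (Nat.floor_le hx0), (lt_div_iff₀' hm').2 (Nat.lt_floor_add_one _)⟩]
  exact ⟨mul_nonneg hm'.le (popularity_nonneg hF m _),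
    mul_le_of_le_one_right hm'.le (popularity_le_one hF m _)⟩

theorem IsPopularity.hasStrictDerivAt (hF : IsPopularity F) {x : ℝ} (hx : x ∈ Ioo 0 1) :
    HasStrictDerivAt F (deriv F x) x :=
  (hF.contDiff.contDiffAt (isOpen_Ioo.mem_nhds hx)).hasStrictDerivAt one_ne_zero

theorem IsPopularity.deriv_nonneg (hF : IsPopularity F) {x : ℝ} (hx : x ∈ Ioo 0 1) :
    0 ≤ deriv F x := by
  rw [← derivWithin_of_mem_nhds (Icc_mem_nhds hx.1 hx.2)]
  exact hF.mono.derivWithin_nonneg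

/-- Both ends of the cell containing `x` move with `m`; strict differentiability, a consequence of
`C¹`, handles such difference quotients. -/
theorem tendsto_stepDensity (hF : IsPopularity F) {x : ℝ} (hx : x ∈ Ioo 0 1) :
    Tendsto (fun m => stepDensity F m x) atTop (𝓝 (deriv F x)) := by
  have hl : Tendsto (fun m : ℕ => ((⌊m * x⌋₊ : ℕ) : ℝ) / m) atTop (𝓝 x) := by
    have := (tendsto_nat_floor_mul_div_atTop hx.1.le).comp (tendsto_natCast_atTop_atTop (R := ℝ))
    refine this.congr fun m => ?_
    simp [mul_comm]
  have hr : Tendsto (fun m : ℕ => ((⌊m * x⌋₊ : ℕ) + 1 : ℝ) / m) atTop (𝓝 x) := by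
    have := hl.add tendsto_one_div_atTop_nhds_zero_nat
    rw [add_zero] at this
    exact this.congr fun m => (add_div _ _ _).symm
  have ho := ((hF.hasStrictDerivAt hx).isLittleO).comp_tendsto (hr.prodMk_nhds hl)
  rw [← tendsto_sub_nhds_zero_iff]
  refine (ho.tendsto_div_nhds_zero).congr' ?_
  filter_upwards [eventually_gt_atTop 0] with m hm
  have hm' : (m : ℝ) ≠ 0 := by exact_mod_cast hm.ne'
  have h1 : ((⌊m * x⌋₊ : ℕ) + 1 : ℝ) / m - ((⌊m * x⌋₊ : ℕ) : ℝ) / m = 1 / m := by ring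
  simp only [Function.comp_apply, stepDensity, h1, ContinuousLinearMap.toSpanSingleton_apply,
    smul_eq_mul]
  field_simp

theorem ae_mem_Ioo : ∀ᵐ x : ℝ, x ∈ uIoc (0 : ℝ) 1 → x ∈ Ioo (0 : ℝ) 1 := by
  filter_upwards [MeasureTheory.volume.ae_ne (1 : ℝ)] with x hx h
  rw [uIoc_of_le zero_le_one] at h
  exact ⟨h.1, lt_of_le_of_ne h.2 hx⟩

variable {m t : ℕ → ℕ} {a θ : ℝ}

/-- In the limits below, `m` counts the files of one provider, `t` the requests of all providers,
and `a` is the provider's share of the requests. -/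
theorem tendsto_one_sub_stepDensity_pow (hF : IsPopularity F) (hm : Tendsto m atTop atTop)
    (ht : Tendsto (fun n => (t n : ℝ) / m n) atTop (𝓝 θ)) {x : ℝ} (hx : x ∈ Ioo 0 1) :
    Tendsto (fun n => (1 - a * (stepDensity F (m n) x / m n)) ^ t n) atTop
      (𝓝 (Real.exp (-(a * deriv F x * θ)))) := by
  have hm' : Tendsto (fun n => (m n : ℝ)) atTop atTop := tendsto_natCast_atTop_atTop.comp hm
  have hg := (tendsto_stepDensity hF hx).comp hm
  refine tendsto_one_sub_pow_exp ?_ ?_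
  · simpa using (hg.div_atTop hm').const_mul a
  · have := (hg.const_mul a).mul ht
    exact this.congr fun n => by simp only [Function.comp_apply]; ring

theorem one_sub_mul_mem (ha : a ∈ Ioc 0 1) {m : ℕ} (hm : 0 < m) {y : ℝ}
    (hy : y ∈ Icc (0 : ℝ) m) : 1 - a * (y / m) ∈ Icc (0 : ℝ) 1 := by
  have hm' : (0 : ℝ) < m := by exact_mod_cast hm
  have h1 : 0 ≤ y / m := div_nonneg hy.1 hm'.le
  have h2 : y / m ≤ 1 := (div_le_one hm').2 hy.2
  constructor <;> nlinarith [ha.1, ha.2]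

theorem tendsto_unseen (hF : IsPopularity F) (ha : a ∈ Ioc 0 1) (hm : Tendsto m atTop atTop)
    (ht : Tendsto (fun n => (t n : ℝ) / m n) atTop (𝓝 θ)) :
    Tendsto (fun n => (∑ i, (1 - a * popularity F (m n) i) ^ t n) / m n) atTop
      (𝓝 (∫ x in (0 : ℝ)..1, Real.exp (-(a * deriv F x * θ)))) := by
  have hlim : Tendsto (fun n => ∫ x in (0 : ℝ)..1, (1 - a * (stepDensity F (m n) x / m n)) ^ t n)
      atTop (𝓝 (∫ x in (0 : ℝ)..1, Real.exp (-(a * deriv F x * θ)))) := by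
    refine intervalIntegral.tendsto_integral_filter_of_dominated_convergence (fun _ => 1) ?_ ?_
      intervalIntegrable_const ?_
    · refine Eventually.of_forall fun n => Measurable.aestronglyMeasurable ?_
      have := measurable_stepDensity F (m n)
      fun_prop
    · filter_upwards [hm.eventually_gt_atTop 0] with n hn
      filter_upwards [ae_mem_Ioo] with x hx hx'
      have h := one_sub_mul_mem ha hn (stepDensity_mem hF hn ⟨(hx hx').1.le, (hx hx').2⟩)
      rw [Real.norm_of_nonneg (pow_nonneg h.1 _)]
      exact pow_le_one₀ h.1 h.2
    · filter_upwards [ae_mem_Ioo] with x hx hx'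
      exact tendsto_one_sub_stepDensity_pow hF hm ht (hx hx')
  refine hlim.congr' ?_
  filter_upwards [hm.eventually_gt_atTop 0] with n hn
  have hm' : (m n : ℝ) ≠ 0 := by exact_mod_cast hn.ne'
  have := sum_popularity_eq_integral (F := F) hn (fun y => (1 - a * (y / m n)) ^ t n)
  simp only [mul_div_cancel_left₀ _ hm'] at this
  rw [this, mul_div_cancel_left₀ _ hm']

/-- From `u * exp (-u) ≤ 1` with `u = a * (t / m) * y`. The bound is uniform in `y`, so an unbounded
density does no harm. -/
theorem mul_one_sub_pow_le (ha : 0 < a) {m t : ℕ} (ht : 0 < t) (hm : 0 < m) {y : ℝ} (hy : 0 ≤ y)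
    (h : 0 ≤ 1 - a * (y / m)) :
    y * (1 - a * (y / m)) ^ t ≤ (a * (t / m : ℝ))⁻¹ := by
  have hm' : (0 : ℝ) < m := by exact_mod_cast hm
  have ht' : (0 : ℝ) < t := by exact_mod_cast ht
  have hc : 0 < a * (t / m : ℝ) := by positivity
  calc y * (1 - a * (y / m)) ^ t ≤ y * Real.exp (-(a * (y / m))) ^ t :=
        mul_le_mul_of_nonneg_left (pow_le_pow_left₀ h (Real.one_sub_le_exp_neg _) _) hy
    _ = (a * (t / m : ℝ))⁻¹ * ((a * (t / m : ℝ) * y) * Real.exp (-(a * (t / m : ℝ) * y))) := by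
        rw [← Real.exp_nat_mul, ← mul_assoc, ← mul_assoc, inv_mul_cancel₀ hc.ne', one_mul]
        congr 2; ring
    _ ≤ (a * (t / m : ℝ))⁻¹ * 1 := by
        refine mul_le_mul_of_nonneg_left ?_ (inv_nonneg.2 hc.le)
        exact (Real.mul_exp_neg_le_exp_neg_one _).trans (Real.exp_le_one_iff.2 (by norm_num))
    _ = _ := mul_one _

theorem tendsto_miss (hF : IsPopularity F) (ha : a ∈ Ioc 0 1) (hm : Tendsto m atTop atTop)
    (hθ : 0 < θ) (ht : Tendsto (fun n => (t n : ℝ) / m n) atTop (𝓝 θ)) :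
    Tendsto (fun n => ∑ i, popularity F (m n) i * (1 - a * popularity F (m n) i) ^ t n) atTop
      (𝓝 (∫ x in (0 : ℝ)..1, deriv F x * Real.exp (-(a * deriv F x * θ)))) := by
  have hlim : Tendsto (fun n => ∫ x in (0 : ℝ)..1,
      stepDensity F (m n) x * (1 - a * (stepDensity F (m n) x / m n)) ^ t n)
      atTop (𝓝 (∫ x in (0 : ℝ)..1, deriv F x * Real.exp (-(a * deriv F x * θ)))) := by
    refine intervalIntegral.tendsto_integral_filter_of_dominated_convergence
      -- Eventually `t n / m n > θ / 2`, which makes the bound of `mul_one_sub_pow_le` a constant.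
      (fun _ => (a * (θ / 2))⁻¹) ?_ ?_ intervalIntegrable_const ?_
    · refine Eventually.of_forall fun n => Measurable.aestronglyMeasurable ?_
      have := measurable_stepDensity F (m n)
      fun_prop
    · filter_upwards [hm.eventually_gt_atTop 0, ht.eventually_const_lt (half_lt_self hθ)]
        with n hn htn
      have ht0 : 0 < t n := by
        rcases Nat.eq_zero_or_pos (t n) with h | h
        · rw [h, Nat.cast_zero, zero_div] at htn; linarith
        · exact h
      filter_upwards [ae_mem_Ioo] with x hx hx'
      have hs := stepDensity_mem hF hn (x := x) ⟨(hx hx').1.le, (hx hx').2⟩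
      have h := one_sub_mul_mem ha hn hs
      rw [Real.norm_of_nonneg (mul_nonneg hs.1 (pow_nonneg h.1 _))]
      refine (mul_one_sub_pow_le ha.1 ht0 hn hs.1 h.1).trans ?_
      have := ha.1
      gcongr
    · filter_upwards [ae_mem_Ioo] with x hx hx'
      exact ((tendsto_stepDensity hF (hx hx')).comp hm).mul
        (tendsto_one_sub_stepDensity_pow hF hm ht (hx hx'))
  refine hlim.congr' ?_
  filter_upwards [hm.eventually_gt_atTop 0] with n hn
  have hm' : (m n : ℝ) ≠ 0 := by exact_mod_cast hn.ne'
  have := sum_popularity_eq_integral (F := F) hn (fun y => y * (1 - a * (y / m n)) ^ t n)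
  simp only [mul_div_cancel_left₀ _ hm', mul_assoc, ← Finset.mul_sum] at this
  exact (mul_left_cancel₀ hm' this).symm

end Density

/-! ### Occupancy and miss probability as functions of the characteristic time. -/

section Asymptotic

variable {F : ℝ → ℝ}

theorem IsPopularity.intervalIntegrable_deriv (hF : IsPopularity F) :
    IntervalIntegrable (deriv F) MeasureTheory.volume 0 1 :=
  MonotoneOn.intervalIntegrable_deriv (by rw [uIcc_of_le zero_le_one]; exact hF.mono)

/-- Monotonicity makes `F'` integrable even if unbounded, and continuity of `F` up to the end points
ensures that no mass is lost there. -/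
theorem IsPopularity.integral_deriv (hF : IsPopularity F) : ∫ x in (0 : ℝ)..1, deriv F x = 1 := by
  rw [intervalIntegral.integral_eq_sub_of_hasDeriv_right_of_le zero_le_one hF.cont
    (fun x hx => (hF.hasStrictDerivAt hx).hasDerivAt.hasDerivWithinAt)
    hF.intervalIntegrable_deriv, hF.zero, hF.one, sub_zero]

/-- An integrand that vanishes only where the density does has a positive integral. -/
theorem IsPopularity.integral_pos (hF : IsPopularity F) {f : ℝ → ℝ}
    (hfi : IntervalIntegrable f MeasureTheory.volume 0 1) (hf : ∀ x ∈ Ioo (0 : ℝ) 1, 0 ≤ f x)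
    (hf0 : ∀ x ∈ Ioo (0 : ℝ) 1, f x = 0 → deriv F x = 0) : 0 < ∫ x in (0 : ℝ)..1, f x := by
  have hae : ∀ᵐ x ∂MeasureTheory.volume.restrict (Ioc (0 : ℝ) 1 ∪ Ioc 1 0),
      x ∈ Ioo (0 : ℝ) 1 := by
    rw [MeasureTheory.ae_restrict_iff' (by measurability)]
    filter_upwards [ae_mem_Ioo] with x hx h
    exact hx (by rwa [uIoc_eq_union])
  have hnn : 0 ≤ᵐ[MeasureTheory.volume.restrict (Ioc (0 : ℝ) 1 ∪ Ioc 1 0)] f :=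
    hae.mono fun x hx => hf x hx
  refine lt_of_le_of_ne ?_ fun h => ?_
  · refine intervalIntegral.integral_nonneg_of_ae_restrict zero_le_one ?_
    rw [Filter.EventuallyLE, MeasureTheory.ae_restrict_iff' measurableSet_Icc]
    filter_upwards [MeasureTheory.volume.ae_ne (0 : ℝ), MeasureTheory.volume.ae_ne (1 : ℝ)]
      with x h0 h1 hx
    exact hf x ⟨lt_of_le_of_ne hx.1 h0.symm, lt_of_le_of_ne hx.2 h1⟩
  -- A zero integral would make `f`, hence `F'`, vanish almost everywhere, although `F'` has
  -- integral `1`.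
  · have hz := (intervalIntegral.integral_eq_zero_iff_of_nonneg_ae hnn hfi).1 h.symm
    have hd : deriv F =ᵐ[MeasureTheory.volume.restrict (Ioc (0 : ℝ) 1 ∪ Ioc 1 0)] 0 := by
      filter_upwards [hz, hae] with x hx hx'
      exact hf0 x hx' hx
    have h0 := (intervalIntegral.integral_eq_zero_iff_of_nonneg_ae
      (hae.mono fun x hx => hF.deriv_nonneg hx) hF.intervalIntegrable_deriv).2 hd
    rw [hF.integral_deriv] at h0
    exact one_ne_zero h0

theorem exp_neg_deriv_mem (hF : IsPopularity F) {τ : ℝ} (hτ : 0 ≤ τ) {x : ℝ}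
    (hx : x ∈ Ioo (0 : ℝ) 1) : Real.exp (-(deriv F x * τ)) ∈ Ioc (0 : ℝ) 1 :=
  ⟨Real.exp_pos _, Real.exp_le_one_iff.2
    (neg_nonpos.2 (mul_nonneg (hF.deriv_nonneg hx) hτ))⟩

theorem measurable_exp_neg_deriv (F : ℝ → ℝ) (τ : ℝ) :
    Measurable fun x => Real.exp (-(deriv F x * τ)) := by
  have := measurable_deriv F
  fun_prop

theorem intervalIntegrable_exp (hF : IsPopularity F) {τ : ℝ} (hτ : 0 ≤ τ) :
    IntervalIntegrable (fun x => Real.exp (-(deriv F x * τ))) MeasureTheory.volume 0 1 := by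
  refine (intervalIntegrable_const (c := (1 : ℝ))).mono_fun
    (measurable_exp_neg_deriv F τ).aestronglyMeasurable ?_
  rw [Filter.EventuallyLE, MeasureTheory.ae_restrict_iff' measurableSet_uIoc]
  filter_upwards [ae_mem_Ioo] with x hx hx'
  have h := exp_neg_deriv_mem hF hτ (hx hx')
  rw [Real.norm_of_nonneg h.1.le, norm_one]
  exact h.2

theorem intervalIntegrable_deriv_mul_exp (hF : IsPopularity F) {τ : ℝ} (hτ : 0 ≤ τ) :
    IntervalIntegrable (fun x => deriv F x * Real.exp (-(deriv F x * τ)))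
      MeasureTheory.volume 0 1 := by
  refine hF.intervalIntegrable_deriv.mono_fun
    ((measurable_deriv F).mul (measurable_exp_neg_deriv F τ)).aestronglyMeasurable ?_
  rw [Filter.EventuallyLE, MeasureTheory.ae_restrict_iff' measurableSet_uIoc]
  filter_upwards [ae_mem_Ioo] with x hx hx'
  have h := exp_neg_deriv_mem hF hτ (hx hx')
  rw [norm_mul, Real.norm_of_nonneg h.1.le]
  exact mul_le_of_le_one_right (norm_nonneg _) h.2

theorem occupancy_eq (hF : IsPopularity F) {τ : ℝ} (hτ : 0 ≤ τ) :
    occupancy F τ = 1 - ∫ x in (0 : ℝ)..1, Real.exp (-(deriv F x * τ)) := by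
  rw [occupancy, intervalIntegral.integral_sub intervalIntegrable_const
    (intervalIntegrable_exp hF hτ)]
  simp

theorem occupancy_zero (F : ℝ → ℝ) : occupancy F 0 = 0 := by simp [occupancy]

theorem missAt_zero (hF : IsPopularity F) : missAt F 0 = 1 := by
  simp [missAt, hF.integral_deriv]

theorem strictMonoOn_occupancy (hF : IsPopularity F) : StrictMonoOn (occupancy F) (Ici 0) := by
  intro s hs t ht hst
  rw [occupancy_eq hF hs, occupancy_eq hF ht, sub_lt_sub_iff_left, ← sub_pos,
    ← intervalIntegral.integral_sub (intervalIntegrable_exp hF hs) (intervalIntegrable_exp hF ht)]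
  refine hF.integral_pos ((intervalIntegrable_exp hF hs).sub (intervalIntegrable_exp hF ht))
    (fun x hx => ?_) fun x hx h => ?_
  · have := hF.deriv_nonneg hx
    rw [sub_nonneg, Real.exp_le_exp, neg_le_neg_iff]
    exact mul_le_mul_of_nonneg_left hst.le this
  · rw [sub_eq_zero, Real.exp_eq_exp, neg_inj] at h
    by_contra h0
    exact hst.ne (mul_left_cancel₀ h0 h)

/-- Keeps limiting hit rates positive, where utilities are continuous. -/
theorem missAt_lt_one (hF : IsPopularity F) {τ : ℝ} (hτ : 0 < τ) : missAt F τ < 1 := by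
  rw [← hF.integral_deriv, missAt, ← sub_pos, ← intervalIntegral.integral_sub
    hF.intervalIntegrable_deriv (intervalIntegrable_deriv_mul_exp hF hτ.le)]
  refine hF.integral_pos (hF.intervalIntegrable_deriv.sub
    (intervalIntegrable_deriv_mul_exp hF hτ.le)) (fun x hx => ?_) fun x hx h => ?_
  · exact sub_nonneg.2 (mul_le_of_le_one_right (hF.deriv_nonneg hx)
      (exp_neg_deriv_mem hF hτ.le hx).2)
  · by_contra h0
    have h1 : deriv F x * 1 = deriv F x * Real.exp (-(deriv F x * τ)) := by linarith
    have h2 := mul_left_cancel₀ h0 h1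
    rw [eq_comm, Real.exp_eq_one_iff, neg_eq_zero] at h2
    exact (mul_ne_zero h0 hτ.ne') h2

/-- The general filter serves both continuity on `[0, ∞)` and the limit at infinity. -/
theorem tendsto_integral_exp (hF : IsPopularity F) {l : Filter ℝ} [l.IsCountablyGenerated]
    (hl : ∀ᶠ τ in l, 0 ≤ τ) {g : ℝ → ℝ}
    (hg : ∀ x ∈ Ioo (0 : ℝ) 1, Tendsto (fun τ => Real.exp (-(deriv F x * τ))) l (𝓝 (g x))) :
    Tendsto (occupancy F) l (𝓝 (1 - ∫ x in (0 : ℝ)..1, g x)) := by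
  have h : Tendsto (fun τ => 1 - ∫ x in (0 : ℝ)..1, Real.exp (-(deriv F x * τ))) l
      (𝓝 (1 - ∫ x in (0 : ℝ)..1, g x)) := by
    refine tendsto_const_nhds.sub
      (intervalIntegral.tendsto_integral_filter_of_dominated_convergence (fun _ => 1) ?_ ?_
      intervalIntegrable_const ?_)
    · exact Eventually.of_forall fun τ => (measurable_exp_neg_deriv F τ).aestronglyMeasurable
    · filter_upwards [hl] with τ hτ
      filter_upwards [ae_mem_Ioo] with x hx hx'
      have h := exp_neg_deriv_mem hF hτ (hx hx')
      rw [Real.norm_of_nonneg h.1.le]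
      exact h.2
    · filter_upwards [ae_mem_Ioo] with x hx hx'
      exact hg x (hx hx')
  refine h.congr' ?_
  filter_upwards [hl] with τ hτ
  exact (occupancy_eq hF hτ).symm

theorem tendsto_integral_deriv_mul_exp (hF : IsPopularity F) {l : Filter ℝ}
    [l.IsCountablyGenerated] (hl : ∀ᶠ τ in l, 0 ≤ τ) {g : ℝ → ℝ}
    (hg : ∀ x ∈ Ioo (0 : ℝ) 1,
      Tendsto (fun τ => deriv F x * Real.exp (-(deriv F x * τ))) l (𝓝 (g x))) :
    Tendsto (missAt F) l (𝓝 (∫ x in (0 : ℝ)..1, g x)) := by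
  refine intervalIntegral.tendsto_integral_filter_of_dominated_convergence (deriv F) ?_ ?_
      hF.intervalIntegrable_deriv ?_
  · exact Eventually.of_forall fun τ =>
      ((measurable_deriv F).mul (measurable_exp_neg_deriv F τ)).aestronglyMeasurable
  · filter_upwards [hl] with τ hτ
    filter_upwards [ae_mem_Ioo] with x hx hx'
    have h := exp_neg_deriv_mem hF hτ (hx hx')
    have hd := hF.deriv_nonneg (hx hx')
    rw [Real.norm_of_nonneg (mul_nonneg hd h.1.le)]
    exact mul_le_of_le_one_right hd h.2
  · filter_upwards [ae_mem_Ioo] with x hx hx'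
    exact hg x (hx hx')

theorem continuousOn_occupancy (hF : IsPopularity F) : ContinuousOn (occupancy F) (Ici 0) := by
  intro τ hτ
  rw [ContinuousWithinAt, occupancy_eq hF hτ]
  refine tendsto_integral_exp hF self_mem_nhdsWithin fun x _ => ?_
  exact (Continuous.tendsto (by fun_prop) τ).mono_left nhdsWithin_le_nhds

theorem continuousOn_missAt (hF : IsPopularity F) : ContinuousOn (missAt F) (Ici 0) := by
  intro τ hτ
  refine tendsto_integral_deriv_mul_exp hF self_mem_nhdsWithin fun x _ => ?_
  exact (Continuous.tendsto (by fun_prop) τ).mono_left nhdsWithin_le_nhds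

theorem tendsto_missAt_atTop (hF : IsPopularity F) : Tendsto (missAt F) atTop (𝓝 0) := by
  have h := tendsto_integral_deriv_mul_exp hF (eventually_ge_atTop 0) (g := fun _ => 0)
    fun x hx => ?_
  · simpa using h
  · rcases (hF.deriv_nonneg hx).eq_or_lt with h | h
    · simp [← h]
    · have := (Real.tendsto_exp_neg_atTop_nhds_zero.comp
        (tendsto_id.const_mul_atTop h)).const_mul (deriv F x)
      simpa [Function.comp_def] using this

/-- The fraction of the files that are ever requested. -/
theorem exists_tendsto_occupancy (hF : IsPopularity F) :
    ∃ σ, Tendsto (occupancy F) atTop (𝓝 σ) := by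
  refine ⟨_, tendsto_integral_exp hF (eventually_ge_atTop 0)
    -- As `τ → ∞` the exponential survives exactly where the density vanishes.
    (g := fun x => if deriv F x = 0 then 1 else 0) fun x hx => ?_⟩
  rcases (hF.deriv_nonneg hx).eq_or_lt with h | h
  · simp [← h]
  · have := Real.tendsto_exp_neg_atTop_nhds_zero.comp (tendsto_id.const_mul_atTop h)
    simpa [Function.comp_def, h.ne'] using this

theorem occupancy_lt_of_tendsto (hF : IsPopularity F) {σ : ℝ}
    (hσ : Tendsto (occupancy F) atTop (𝓝 σ)) {τ : ℝ} (hτ : 0 ≤ τ) : occupancy F τ < σ := by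
  have hmono := strictMonoOn_occupancy hF
  refine (hmono hτ (by simpa using (by linarith : (0 : ℝ) ≤ τ + 1)) (lt_add_one τ)).trans_le ?_
  refine ge_of_tendsto hσ ?_
  filter_upwards [eventually_ge_atTop (τ + 1)] with s hs
  exact hmono.monotoneOn (by simpa using (by linarith : (0 : ℝ) ≤ τ + 1))
    (by simpa using (by linarith : (0 : ℝ) ≤ s)) hs

end Asymptotic

/-! ### The miss probability as a function of the occupancy -/

section CharacteristicTime

variable {G M : ℝ → ℝ} {β : ℝ}

/-- By the intermediate value theorem, the equation can only fail because `β` is too large. -/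
theorem lt_of_not_exists_charTime (hcont : ContinuousOn G (Ici 0)) (h0 : G 0 = 0) (hβ : 0 ≤ β)
    (h : ¬∃ τ, 0 ≤ τ ∧ G τ = β) {τ : ℝ} (hτ : 0 ≤ τ) : G τ < β := by
  by_contra hle
  obtain ⟨s, hs, hs'⟩ := intermediate_value_Icc hτ (hcont.mono Icc_subset_Ici_self)
    ⟨h0.le.trans hβ, not_lt.1 hle⟩
  exact h ⟨s, hs.1, hs'⟩

open Classical in
-- The solution is unique by strict monotonicity, so `h.choose` involves no real choice.
theorem dite_charTime_eq (hmono : StrictMonoOn G (Ici 0)) {τ : ℝ} (hτ : 0 ≤ τ) (hG : G τ = β) :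
    (if h : ∃ τ, 0 ≤ τ ∧ G τ = β then M h.choose else 0) = M τ := by
  have h : ∃ τ, 0 ≤ τ ∧ G τ = β := ⟨τ, hτ, hG⟩
  rw [dif_pos h, hmono.injOn h.choose_spec.1 hτ (h.choose_spec.2.trans hG.symm)]

open Classical in
theorem dite_charTime_lt_one (h0 : G 0 = 0) (hM : ∀ τ, 0 < τ → M τ < 1) (hβ : 0 < β) :
    (if h : ∃ τ, 0 ≤ τ ∧ G τ = β then M h.choose else 0) < 1 := by
  split_ifs with h
  · refine hM _ (lt_of_le_of_ne h.choose_spec.1 fun heq => ?_)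
    have := h.choose_spec.2
    rw [← heq, h0] at this
    exact hβ.ne this
  · exact one_pos

open Classical in
theorem tendsto_hitProb_charTime {ι κ : ℕ → Type*} [∀ n, Fintype (ι n)] [∀ n, DecidableEq (ι n)]
    [∀ n, Fintype (κ n)] {q : ∀ n, ι n → ℝ} {p : ∀ n, κ n → ℝ} {e : ∀ n, κ n → ι n} {C : ℕ → ℕ}
    (hq : ∀ᶠ n in atTop, (∀ j, 0 ≤ q n j) ∧ ∑ j, q n j = 1)
    (hp : ∀ᶠ n in atTop, (∀ j, 0 ≤ p n j) ∧ ∑ j, p n j = 1)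
    (hN : Tendsto (fun n => (Fintype.card (ι n) : ℝ)) atTop atTop)
    (hC : Tendsto (fun n => (C n : ℝ) / Fintype.card (ι n)) atTop (𝓝 β)) {t : ℝ → ℕ → ℕ}
    (hG : ∀ τ, 0 < τ →
      Tendsto (fun n => expUnseen (q n) (t τ n) / Fintype.card (ι n)) atTop (𝓝 (1 - G τ)))
    (hM : ∀ τ, 0 < τ →
      Tendsto (fun n => ∑ j, p n j * (1 - q n (e n j)) ^ t τ n) atTop (𝓝 (M τ)))
    (hβ : 0 < β) (h0 : G 0 = 0) (hmono : StrictMonoOn G (Ici 0)) (hcont : ContinuousOn G (Ici 0))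
    (hMcont : ContinuousOn M (Ici 0)) (hMlim : Tendsto M atTop (𝓝 0)) :
    Tendsto (fun n => ∑ j, p n j * cachedProb (C n) (q n) (e n j)) atTop
      (𝓝 (1 - if h : ∃ τ, 0 ≤ τ ∧ G τ = β then M h.choose else 0)) := by
  by_cases h : ∃ τ, 0 ≤ τ ∧ G τ = β
  · obtain ⟨τ, hτ, hGτ⟩ := h
    rw [dite_charTime_eq hmono hτ hGτ]
    have hτ0 : 0 < τ := lt_of_le_of_ne hτ fun heq => by
      rw [← heq, h0] at hGτ; exact hβ.ne hGτ
    exact tendsto_hitProb hq hp hN hC hG hM hτ0 hmono hGτ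
      (hMcont.continuousAt (Ici_mem_nhds hτ0))
  · rw [dif_neg h, sub_zero]
    exact tendsto_hitProb_one hq hp hN hC hG hM
      (fun τ hτ => lt_of_not_exists_charTime hcont h0 hβ.le h hτ.le) hMlim

end CharacteristicTime

theorem tendsto_floor_div {x : ℝ} (hx : 0 ≤ x) {w : ℕ → ℝ} (hw : Tendsto w atTop atTop) :
    Tendsto (fun n => (⌊x * w n⌋₊ : ℝ) / w n) atTop (𝓝 x) :=
  (tendsto_nat_floor_mul_div_atTop hx).comp hw

/-! ### A cache for a single provider -/

section Partition

variable {F : ℝ → ℝ} {β : ℝ}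

theorem asympMiss_eq (hF : IsPopularity F) {τ : ℝ} (hτ : 0 ≤ τ) (h : occupancy F τ = β) :
    asympMiss F β = missAt F τ :=
  dite_charTime_eq (strictMonoOn_occupancy hF) hτ h

theorem asympMiss_zero (hF : IsPopularity F) : asympMiss F 0 = 1 := by
  rw [asympMiss_eq hF le_rfl (occupancy_zero F), missAt_zero hF]

theorem asympMiss_lt_one (hF : IsPopularity F) (hβ : 0 < β) : asympMiss F β < 1 :=
  dite_charTime_lt_one (occupancy_zero F) (fun _ => missAt_lt_one hF) hβ

theorem tendsto_partitionHitProb (hF : IsPopularity F) (hβ : 0 < β) {b : ℕ} (hb : 0 < b) :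
    Tendsto (fun n : ℕ => ∑ i, popularity F (b * n) i *
      cachedProb ⌊β * b * n⌋₊ (popularity F (b * n)) i) atTop (𝓝 (1 - asympMiss F β)) := by
  have hm : Tendsto (fun n => b * n) atTop atTop := tendsto_id.const_mul_atTop' hb
  have hm' : Tendsto (fun n => ((b * n : ℕ) : ℝ)) atTop atTop := tendsto_natCast_atTop_atTop.comp hm
  have hq : ∀ᶠ n : ℕ in atTop, (∀ j, 0 ≤ popularity F (b * n) j) ∧
      ∑ j, popularity F (b * n) j = 1 := by
    filter_upwards [hm.eventually_gt_atTop 0] with n hn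
    exact ⟨popularity_nonneg hF _, sum_popularity hF hn⟩
  refine tendsto_hitProb_charTime (e := fun n i => i)
    (t := fun τ n => ⌊τ * ((b * n : ℕ) : ℝ)⌋₊) hq hq ?_ ?_ ?_ ?_ hβ
    (occupancy_zero F) (strictMonoOn_occupancy hF) (continuousOn_occupancy hF)
    (continuousOn_missAt hF) (tendsto_missAt_atTop hF)
  · simpa only [Fintype.card_fin] using hm'
  · have := tendsto_floor_div hβ.le hm'
    simpa only [Fintype.card_fin, Nat.cast_mul, ← mul_assoc] using this
  · intro τ hτ
    have := tendsto_unseen hF (a := 1) (by simp) hm (tendsto_floor_div hτ.le hm')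
    rw [occupancy_eq hF hτ.le, sub_sub_cancel]
    simpa only [one_mul, Fintype.card_fin, expUnseen] using this
  · intro τ hτ
    have := tendsto_miss hF (a := 1) (by simp) hm hτ (tendsto_floor_div hτ.le hm')
    simpa only [one_mul, missAt] using this

end Partition

/-! ### A shared cache -/

section Shared

variable {K : ℕ} {b : Fin K → ℕ} {lam : Fin K → ℝ} {F : Fin K → ℝ → ℝ} {β : ℝ}

theorem total_pos (hK : 0 < K) (hb : ∀ k, 0 < b k) : 0 < total b :=
  Finset.sum_pos (fun k _ => by exact_mod_cast hb k) ⟨⟨0, hK⟩, Finset.mem_univ _⟩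

theorem sum_rates_pos (hK : 0 < K) (hlam : ∀ k, 0 < lam k) : 0 < ∑ k, lam k :=
  Finset.sum_pos (fun k _ => hlam k) ⟨⟨0, hK⟩, Finset.mem_univ _⟩

theorem sum_div_total (hK : 0 < K) (hb : ∀ k, 0 < b k) : ∑ k, (b k : ℝ) / total b = 1 := by
  rw [← Finset.sum_div]
  exact div_self (total_pos hK hb).ne'

theorem sum_share (hK : 0 < K) (hlam : ∀ k, 0 < lam k) : ∑ k, share lam k = 1 := by
  simp only [share, ← Finset.sum_div]
  exact div_self (sum_rates_pos hK hlam).ne'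

theorem share_mem (hK : 0 < K) (hlam : ∀ k, 0 < lam k) (k : Fin K) : share lam k ∈ Ioc 0 1 := by
  have h : ∀ j, 0 < share lam j := fun j => div_pos (hlam j) (sum_rates_pos hK hlam)
  refine ⟨h k, ?_⟩
  rw [← sum_share hK hlam]
  exact Finset.single_le_sum (fun j _ => (h j).le) (Finset.mem_univ k)

/-- The ratio of the normalized characteristic times of provider `k` and of the shared cache. -/
noncomputable def timeScale (b : Fin K → ℕ) (lam : Fin K → ℝ) (k : Fin K) : ℝ :=
  share lam k * total b / b k

theorem timeScale_pos (hK : 0 < K) (hb : ∀ k, 0 < b k) (hlam : ∀ k, 0 < lam k) (k : Fin K) :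
    0 < timeScale b lam k :=
  div_pos (mul_pos (share_mem hK hlam k).1 (total_pos hK hb)) (by exact_mod_cast hb k)

/-- Of `τ B n` requests, about `a_k τ B n` go to the `b_k n` files of provider `k`: to this
provider, the shared cache is a private one with rescaled time. -/
theorem sharedMissAt_eq (b : Fin K → ℕ) (lam : Fin K → ℝ) (F : Fin K → ℝ → ℝ) (k : Fin K) :
    (fun τ => sharedMissAt b lam F τ k) = fun τ => missAt (F k) (timeScale b lam k * τ) := by
  funext τ
  simp only [sharedMissAt, missAt, timeScale]
  congr! 5
  ring

theorem sharedOccupancy_eq (hK : 0 < K) (hb : ∀ k, 0 < b k) (hlam : ∀ k, 0 < lam k)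
    (hF : ∀ k, IsPopularity (F k)) {τ : ℝ} (hτ : 0 ≤ τ) :
    sharedOccupancy b lam F τ =
      ∑ k, (b k : ℝ) / total b * occupancy (F k) (timeScale b lam k * τ) := by
  have h : ∀ k, occupancy (F k) (timeScale b lam k * τ) = 1 - ∫ x in (0 : ℝ)..1,
      Real.exp (-(share lam k * deriv (F k) x * τ * total b / b k)) := fun k => by
    rw [occupancy_eq (hF k) (mul_nonneg (timeScale_pos hK hb hlam k).le hτ)]
    simp only [timeScale]
    congr! 5
    ring
  simp only [h, mul_sub, mul_one, Finset.sum_sub_distrib, sum_div_total hK hb, sharedOccupancy]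

theorem sharedOccupancy_zero (hK : 0 < K) (hb : ∀ k, 0 < b k) (hlam : ∀ k, 0 < lam k)
    (hF : ∀ k, IsPopularity (F k)) : sharedOccupancy b lam F 0 = 0 := by
  rw [sharedOccupancy_eq hK hb hlam hF le_rfl]
  simp [occupancy_zero]

theorem strictMonoOn_sharedOccupancy (hK : 0 < K) (hb : ∀ k, 0 < b k) (hlam : ∀ k, 0 < lam k)
    (hF : ∀ k, IsPopularity (F k)) : StrictMonoOn (sharedOccupancy b lam F) (Ici 0) := by
  intro s hs t ht hst
  rw [sharedOccupancy_eq hK hb hlam hF hs, sharedOccupancy_eq hK hb hlam hF ht]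
  refine Finset.sum_lt_sum_of_nonempty ⟨⟨0, hK⟩, Finset.mem_univ _⟩ fun k _ => ?_
  have hc := timeScale_pos hK hb hlam k
  exact mul_lt_mul_of_pos_left (strictMonoOn_occupancy (hF k) (mul_nonneg hc.le hs)
    (mul_nonneg hc.le ht) (mul_lt_mul_of_pos_left hst hc))
    (div_pos (by exact_mod_cast hb k) (total_pos hK hb))

theorem continuousOn_sharedOccupancy (hK : 0 < K) (hb : ∀ k, 0 < b k) (hlam : ∀ k, 0 < lam k)
    (hF : ∀ k, IsPopularity (F k)) : ContinuousOn (sharedOccupancy b lam F) (Ici 0) := by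
  refine ContinuousOn.congr ?_ fun τ hτ => sharedOccupancy_eq hK hb hlam hF hτ
  refine continuousOn_finsetSum _ fun k _ => continuousOn_const.mul ?_
  exact (continuousOn_occupancy (hF k)).comp (by fun_prop)
    fun τ hτ => mul_nonneg (timeScale_pos hK hb hlam k).le hτ

theorem asympSharedMiss_eq (hK : 0 < K) (hb : ∀ k, 0 < b k) (hlam : ∀ k, 0 < lam k)
    (hF : ∀ k, IsPopularity (F k)) {τ : ℝ} (hτ : 0 ≤ τ) (h : sharedOccupancy b lam F τ = β)
    (k : Fin K) : asympSharedMiss b lam F β k = missAt (F k) (timeScale b lam k * τ) := by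
  rw [← congrFun (sharedMissAt_eq b lam F k) τ]
  exact dite_charTime_eq (M := fun τ => sharedMissAt b lam F τ k)
    (strictMonoOn_sharedOccupancy hK hb hlam hF) hτ h

theorem asympSharedMiss_zero (hK : 0 < K) (hb : ∀ k, 0 < b k) (hlam : ∀ k, 0 < lam k)
    (hF : ∀ k, IsPopularity (F k)) (k : Fin K) : asympSharedMiss b lam F 0 k = 1 := by
  rw [asympSharedMiss_eq hK hb hlam hF le_rfl (sharedOccupancy_zero hK hb hlam hF), mul_zero,
    missAt_zero (hF k)]

theorem asympSharedMiss_lt_one (hK : 0 < K) (hb : ∀ k, 0 < b k) (hlam : ∀ k, 0 < lam k)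
    (hF : ∀ k, IsPopularity (F k)) (hβ : 0 < β) (k : Fin K) : asympSharedMiss b lam F β k < 1 :=
  dite_charTime_lt_one (M := fun τ => sharedMissAt b lam F τ k)
    (sharedOccupancy_zero hK hb hlam hF) (fun τ hτ => by
      rw [congrFun (sharedMissAt_eq b lam F k) τ]
      exact missAt_lt_one (hF k) (mul_pos (timeScale_pos hK hb hlam k) hτ)) hβ

theorem card_files (b : Fin K → ℕ) (n : ℕ) :
    (Fintype.card (Σ k, Fin (b k * n)) : ℝ) = total b * n := by
  simp [total, Finset.sum_mul]

theorem requestLaw_nonneg (hK : 0 < K) (hlam : ∀ k, 0 < lam k) (hF : ∀ k, IsPopularity (F k))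
    (n : ℕ) (f : Σ k, Fin (b k * n)) : 0 ≤ requestLaw b lam F n f :=
  mul_nonneg (share_mem hK hlam f.1).1.le (popularity_nonneg (hF f.1) _ _)

theorem sum_requestLaw (hK : 0 < K) (hb : ∀ k, 0 < b k) (hlam : ∀ k, 0 < lam k)
    (hF : ∀ k, IsPopularity (F k)) {n : ℕ} (hn : 0 < n) : ∑ f, requestLaw b lam F n f = 1 := by
  rw [Fintype.sum_sigma, ← sum_share hK hlam]
  refine Finset.sum_congr rfl fun k _ => ?_
  simp only [requestLaw, ← Finset.mul_sum, sum_popularity (hF k) (Nat.mul_pos (hb k) hn), mul_one]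

theorem tendsto_request_ratio (hK : 0 < K) (hb : ∀ k, 0 < b k) {τ : ℝ} (hτ : 0 ≤ τ) (k : Fin K) :
    Tendsto (fun n : ℕ => (⌊τ * (total b * n)⌋₊ : ℝ) / (b k * n : ℕ)) atTop
      (𝓝 (τ * (total b / b k))) := by
  have hB := total_pos hK hb
  have hw : Tendsto (fun n : ℕ => total b * n) atTop atTop :=
    tendsto_natCast_atTop_atTop.const_mul_atTop hB
  refine ((tendsto_floor_div hτ hw).mul_const (total b / b k)).congr' ?_
  filter_upwards [eventually_gt_atTop 0] with n hn
  have hn' : (n : ℝ) ≠ 0 := by exact_mod_cast hn.ne'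
  have hbk : (b k : ℝ) ≠ 0 := by exact_mod_cast (hb k).ne'
  push_cast
  field_simp

theorem tendsto_files (hb : ∀ k, 0 < b k) (k : Fin K) :
    Tendsto (fun n => b k * n) atTop atTop :=
  tendsto_id.const_mul_atTop' (hb k)

theorem tendsto_sharedUnseen (hK : 0 < K) (hb : ∀ k, 0 < b k) (hlam : ∀ k, 0 < lam k)
    (hF : ∀ k, IsPopularity (F k)) {τ : ℝ} (hτ : 0 ≤ τ) :
    Tendsto (fun n : ℕ => expUnseen (requestLaw b lam F n) ⌊τ * (total b * n)⌋₊ /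
      Fintype.card (Σ k, Fin (b k * n))) atTop (𝓝 (1 - sharedOccupancy b lam F τ)) := by
  have h : Tendsto (fun n : ℕ => ∑ k, (b k : ℝ) / total b *
      ((∑ i, (1 - share lam k * popularity (F k) (b k * n) i) ^ ⌊τ * (total b * n)⌋₊) /
        (b k * n : ℕ))) atTop (𝓝 (1 - sharedOccupancy b lam F τ)) := by
    rw [sharedOccupancy, sub_sub_cancel]
    refine tendsto_finsetSum _ fun k _ => Tendsto.const_mul _ ?_
    have := tendsto_unseen (hF k) (share_mem hK hlam k) (tendsto_files hb k)
      (tendsto_request_ratio hK hb hτ k)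
    simpa only [← mul_assoc, mul_div_assoc] using this
  refine h.congr fun n => ?_
  rw [expUnseen, Fintype.sum_sigma, Finset.sum_div, card_files]
  refine Finset.sum_congr rfl fun k _ => ?_
  rw [Nat.cast_mul, div_mul_div_comm, mul_left_comm (total b),
    mul_div_mul_left _ _ (by exact_mod_cast (hb k).ne' : (b k : ℝ) ≠ 0)]
  rfl

theorem tendsto_sharedMiss (hK : 0 < K) (hb : ∀ k, 0 < b k) (hlam : ∀ k, 0 < lam k)
    (hF : ∀ k, IsPopularity (F k)) {τ : ℝ} (hτ : 0 < τ) (k : Fin K) :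
    Tendsto (fun n : ℕ => ∑ i, popularity (F k) (b k * n) i *
      (1 - requestLaw b lam F n ⟨k, i⟩) ^ ⌊τ * (total b * n)⌋₊) atTop
      (𝓝 (sharedMissAt b lam F τ k)) := by
  have := tendsto_miss (hF k) (share_mem hK hlam k) (tendsto_files hb k)
    (mul_pos hτ (div_pos (total_pos hK hb) (by exact_mod_cast hb k)))
    (tendsto_request_ratio hK hb hτ.le k)
  simpa only [sharedMissAt, requestLaw, ← mul_assoc, mul_div_assoc] using this

theorem tendsto_sharedHitProb (hK : 0 < K) (hb : ∀ k, 0 < b k) (hlam : ∀ k, 0 < lam k)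
    (hF : ∀ k, IsPopularity (F k)) (hβ : 0 < β) (k : Fin K) :
    Tendsto (fun n : ℕ => ∑ i, popularity (F k) (b k * n) i *
      cachedProb ⌊β * total b * n⌋₊ (requestLaw b lam F n) ⟨k, i⟩) atTop
      (𝓝 (1 - asympSharedMiss b lam F β k)) := by
  have hw : Tendsto (fun n : ℕ => total b * n) atTop atTop :=
    tendsto_natCast_atTop_atTop.const_mul_atTop (total_pos hK hb)
  have hc := timeScale_pos hK hb hlam k
  refine tendsto_hitProb_charTime (ι := fun n => Σ k, Fin (b k * n)) (κ := fun n => Fin (b k * n))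
    (q := requestLaw b lam F) (p := fun n => popularity (F k) (b k * n))
    (e := fun n i => ⟨k, i⟩) (C := fun n => ⌊β * total b * n⌋₊)
    (t := fun τ n => ⌊τ * (total b * n)⌋₊) (G := sharedOccupancy b lam F)
    (M := fun τ => sharedMissAt b lam F τ k)
    ?_ ?_ ?_ ?_ (fun τ hτ => tendsto_sharedUnseen hK hb hlam hF hτ.le)
    (fun τ hτ => tendsto_sharedMiss hK hb hlam hF hτ k) hβ
    (sharedOccupancy_zero hK hb hlam hF) (strictMonoOn_sharedOccupancy hK hb hlam hF)
    (continuousOn_sharedOccupancy hK hb hlam hF) ?_ ?_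
  · filter_upwards [eventually_gt_atTop 0] with n hn
    exact ⟨requestLaw_nonneg hK hlam hF n, sum_requestLaw hK hb hlam hF hn⟩
  · filter_upwards [eventually_gt_atTop 0] with n hn
    exact ⟨popularity_nonneg (hF k) _, sum_popularity (hF k) (Nat.mul_pos (hb k) hn)⟩
  · simpa only [card_files] using hw
  · simpa only [card_files, mul_assoc] using tendsto_floor_div hβ.le hw
  · rw [sharedMissAt_eq]
    exact (continuousOn_missAt (hF k)).comp (by fun_prop) fun τ hτ => mul_nonneg hc.le hτ
  · rw [sharedMissAt_eq]
    exact (tendsto_missAt_atTop (hF k)).comp (tendsto_id.const_mul_atTop hc)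

/-- The partition in which every provider has the same occupancy as in the shared cache. -/
theorem exists_feasible_asympMiss_eq (hK : 0 < K) (hb : ∀ k, 0 < b k) (hlam : ∀ k, 0 < lam k)
    (hF : ∀ k, IsPopularity (F k)) (hβ : 0 ≤ β) :
    ∃ βs ∈ feasible b β, ∀ k, asympMiss (F k) (βs k) = asympSharedMiss b lam F β k := by
  by_cases h : ∃ τ, 0 ≤ τ ∧ sharedOccupancy b lam F τ = β
  · obtain ⟨τ, hτ, hτβ⟩ := h
    have hc : ∀ k, 0 ≤ timeScale b lam k * τ :=
      fun k => mul_nonneg (timeScale_pos hK hb hlam k).le hτ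
    refine ⟨fun k => occupancy (F k) (timeScale b lam k * τ), ⟨fun k => ?_, ?_⟩, fun k => ?_⟩
    · rw [← occupancy_zero (F k)]
      exact (strictMonoOn_occupancy (hF k)).monotoneOn self_mem_Ici (hc k) (hc k)
    · rw [← sharedOccupancy_eq hK hb hlam hF hτ, hτβ]
    · rw [asympSharedMiss_eq hK hb hlam hF hτ hτβ, asympMiss_eq (hF k) (hc k) rfl]
  -- The shared cache now exceeds the total of the limiting occupancies `σ k`, weakly at least.
  · choose σ hσ using fun k => exists_tendsto_occupancy (hF k)
    have hle : ∑ k, (b k : ℝ) / total b * σ k ≤ β := by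
      have hlim : Tendsto (fun τ => ∑ k, (b k : ℝ) / total b *
          occupancy (F k) (timeScale b lam k * τ)) atTop
          (𝓝 (∑ k, (b k : ℝ) / total b * σ k)) :=
        tendsto_finsetSum _ fun k _ => ((hσ k).comp
          (tendsto_id.const_mul_atTop (timeScale_pos hK hb hlam k))).const_mul _
      refine le_of_tendsto hlim ?_
      filter_upwards [eventually_ge_atTop 0] with τ hτ
      rw [← sharedOccupancy_eq hK hb hlam hF hτ]
      exact (lt_of_not_exists_charTime (continuousOn_sharedOccupancy hK hb hlam hF)
        (sharedOccupancy_zero hK hb hlam hF) hβ h hτ).le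
    have hσ0 : ∀ k, 0 < σ k := fun k => by
      rw [← occupancy_zero (F k)]
      exact occupancy_lt_of_tendsto (hF k) (hσ k) le_rfl
    -- Each provider gets `σ k` plus the same surplus; the weights sum to `1`, so this is feasible.
    -- No finite time reaches `σ k`, so both miss probabilities take the default value `0`.
    refine ⟨fun k => σ k + (β - ∑ k, (b k : ℝ) / total b * σ k), ⟨fun k => ?_, ?_⟩, fun k => ?_⟩
    · linarith [hσ0 k]
    · simp only [mul_add, Finset.sum_add_distrib, ← Finset.sum_mul, sum_div_total hK hb]
      ring
    · rw [asympSharedMiss, dif_neg h, asympMiss, dif_neg]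
      rintro ⟨τ, hτ, hτ'⟩
      have := occupancy_lt_of_tendsto (hF k) (hσ k) hτ
      linarith

end Shared

/-! ### Utilities -/

theorem IsUtility.ne_top {U : ℝ → EReal} (hU : IsUtility U) {h : ℝ} (hh : 0 ≤ h) : U h ≠ ⊤ :=
  ne_top_of_le_ne_top (hU.finite (h + 1) (by linarith)).2
    (hU.mono hh (by simpa using (by linarith : 0 ≤ h + 1)) (by linarith))

theorem IsUtility.continuousAt {U : ℝ → EReal} (hU : IsUtility U) {h : ℝ} (hh : 0 < h) :
    ContinuousAt U h := by
  have hc := (hU.concave.continuousOn isOpen_Ioi).continuousAt (Ioi_mem_nhds hh)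
  refine (continuous_coe_real_ereal.continuousAt.comp hc).congr ?_
  filter_upwards [Ioi_mem_nhds hh] with x hx
  exact EReal.coe_toReal (hU.finite x hx).2 (hU.finite x hx).1

/-- Addition in `EReal` is continuous away from `⊤ + ⊥`. Limits equal to `⊥` are harmless once `⊤`
is excluded, so the induction carries this along. -/
theorem tendsto_sum_ereal {κ α : Type*} {l : Filter α} {f : κ → α → EReal} {x : κ → EReal}
    (hx : ∀ k, x k ≠ ⊤) (s : Finset κ) (h : ∀ k, Tendsto (f k) l (𝓝 (x k))) :
    Tendsto (fun a => ∑ k ∈ s, f k a) l (𝓝 (∑ k ∈ s, x k)) ∧ ∑ k ∈ s, x k ≠ ⊤ := by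
  classical
  induction s using Finset.induction_on with
  | empty => simpa using tendsto_const_nhds
  | insert k s hk ih =>
    simp only [Finset.sum_insert hk]
    exact ⟨(EReal.continuousAt_add (p := (x k, ∑ j ∈ s, x j)) (Or.inl (hx k))
      (Or.inr ih.2)).tendsto.comp ((h k).prodMk_nhds ih.1), EReal.add_ne_top (hx k) ih.2⟩

/-- A utility may jump at `0`, so a zero limit is allowed only for hit rates that are identically
zero. -/
theorem tendsto_sum_utility {K : ℕ} {U : Fin K → ℝ → EReal} (hU : ∀ k, IsUtility (U k))
    {h : Fin K → ℕ → ℝ} {h₀ : Fin K → ℝ}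
    (hh : ∀ k, 0 < h₀ k ∧ Tendsto (h k) atTop (𝓝 (h₀ k)) ∨ h₀ k = 0 ∧ ∀ n, h k n = 0) :
    Tendsto (fun n => ∑ k, U k (h k n)) atTop (𝓝 (∑ k, U k (h₀ k))) := by
  refine (tendsto_sum_ereal (f := fun k n => U k (h k n)) (fun k => (hU k).ne_top ?_) _
    fun k => ?_).1
  · rcases hh k with ⟨h1, -⟩ | ⟨h1, -⟩
    exacts [h1.le, h1.ge]
  · rcases hh k with ⟨h1, h2⟩ | ⟨h1, h2⟩
    · exact ((hU k).continuousAt h1).tendsto.comp h2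
    · simpa only [h1, h2] using tendsto_const_nhds

section Main

variable {K : ℕ} {b : Fin K → ℕ} {lam : Fin K → ℝ} {F : Fin K → ℝ → ℝ} {U : Fin K → ℝ → EReal}
  {β : ℝ}

theorem tendsto_sharedUtility (hK : 0 < K) (hb : ∀ k, 0 < b k) (hlam : ∀ k, 0 < lam k)
    (hF : ∀ k, IsPopularity (F k)) (hU : ∀ k, IsUtility (U k)) (hβ : 0 ≤ β) :
    Tendsto (fun n : ℕ => sharedUtility b lam F U n ⌊β * total b * n⌋₊) atTop
      (𝓝 (asympSharedUtility b lam F U β)) := by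
  refine tendsto_sum_utility hU fun k => ?_
  rcases hβ.eq_or_lt with rfl | hβ
  -- For `β = 0` the capacity is `0` and nothing is ever cached.
  · right
    simp [asympSharedMiss_zero hK hb hlam hF, sharedHitRate, cachedProb_zero]
  · exact Or.inl ⟨mul_pos (hlam k) (sub_pos.2 (asympSharedMiss_lt_one hK hb hlam hF hβ k)),
      (tendsto_sharedHitProb hK hb hlam hF hβ k).const_mul _⟩

theorem tendsto_partitionUtility (hb : ∀ k, 0 < b k) (hlam : ∀ k, 0 < lam k)
    (hF : ∀ k, IsPopularity (F k)) (hU : ∀ k, IsUtility (U k)) {βs : Fin K → ℝ}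
    (hβs : ∀ k, 0 ≤ βs k) :
    Tendsto (fun n : ℕ => partitionUtility b lam F U n (fun k => ⌊βs k * b k * n⌋₊)) atTop
      (𝓝 (asympPartitionUtility lam F U βs)) := by
  refine tendsto_sum_utility hU fun k => ?_
  rcases (hβs k).eq_or_lt with h | h
  · right
    simp [← h, asympMiss_zero (hF k), partitionHitRate, cachedProb_zero]
  · exact Or.inl ⟨mul_pos (hlam k) (sub_pos.2 (asympMiss_lt_one (hF k) h)),
      (tendsto_partitionHitProb (hF k) h (hb k)).const_mul _⟩

/-- Makes the rounded feasible partition a competitor in the finite optimum, which gives the bound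
on the `liminf`. -/
theorem sum_floor_le (hK : 0 < K) (hb : ∀ k, 0 < b k) {βs : Fin K → ℝ} (hβs : βs ∈ feasible b β)
    (n : ℕ) : ∑ k, ⌊βs k * b k * n⌋₊ ≤ ⌊β * total b * n⌋₊ := by
  refine Nat.le_floor ?_
  rw [Nat.cast_sum]
  calc ∑ k, (⌊βs k * b k * n⌋₊ : ℝ) ≤ ∑ k, βs k * b k * n :=
        Finset.sum_le_sum fun k _ => Nat.floor_le
          (mul_nonneg (mul_nonneg (hβs.1 k) (Nat.cast_nonneg _)) (Nat.cast_nonneg _))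
    _ = β * total b * n := by
        have hB := (total_pos hK hb).ne'
        rw [← hβs.2, Finset.sum_mul, Finset.sum_mul]
        refine Finset.sum_congr rfl fun k _ => ?_
        field_simp

end Main

end LRUCache

open LRUCache in
theorem theorem2 {K : ℕ} (hK : 0 < K) (b : Fin K → ℕ) (hb : ∀ k, 0 < b k)
    (lam : Fin K → ℝ) (hlam : ∀ k, 0 < lam k)
    (F : Fin K → ℝ → ℝ) (hF : ∀ k, IsPopularity (F k))
    (U : Fin K → ℝ → EReal) (hU : ∀ k, IsUtility (U k))
    (β : ℝ) (hβ : 0 ≤ β) :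
    -- with a shared LRU cache of size `β B n`, the sum of utilities converges to `U^(s)`
    Tendsto (fun n : ℕ => sharedUtility b lam F U n ⌊β * total b * n⌋₊) atTop
      (𝓝 (asympSharedUtility b lam F U β)) ∧
    -- with LRU partitions of sizes `β_k b_k n`, it converges to `U^(p)`
    (∀ βs ∈ feasible b β,
      Tendsto (fun n : ℕ => partitionUtility b lam F U n (fun k => ⌊βs k * b k * n⌋₊)) atTop
        (𝓝 (asympPartitionUtility lam F U βs))) ∧
    -- some feasible partition, hence the optimal one, is asymptotically as good as sharing
    (∃ βs ∈ feasible b β,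
      asympSharedUtility b lam F U β ≤ asympPartitionUtility lam F U βs) ∧
    (asympSharedUtility b lam F U β ≤
      ⨆ βs ∈ feasible b β, asympPartitionUtility lam F U βs) ∧
    -- the same for the optimal partitions of the finite caches
    asympSharedUtility b lam F U β ≤
      liminf (fun n : ℕ => optPartitionUtility b lam F U n ⌊β * total b * n⌋₊) atTop := by
  obtain ⟨βs, hβs, heq⟩ := exists_feasible_asympMiss_eq hK hb hlam hF hβ
  -- Equality holds, since the miss probabilities agree provider by provider.
  have hle : asympSharedUtility b lam F U β ≤ asympPartitionUtility lam F U βs := by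
    simp only [asympSharedUtility, asympPartitionUtility, heq, le_refl]
  have hlim : ∀ βs ∈ feasible b β,
      Tendsto (fun n : ℕ => partitionUtility b lam F U n (fun k => ⌊βs k * b k * n⌋₊)) atTop
        (𝓝 (asympPartitionUtility lam F U βs)) :=
    fun βs hβs => tendsto_partitionUtility hb hlam hF hU hβs.1
  refine ⟨tendsto_sharedUtility hK hb hlam hF hU hβ, hlim, ⟨βs, hβs, hle⟩,
    hle.trans (le_iSup₂ (f := fun βs _ => asympPartitionUtility lam F U βs) βs hβs), hle.trans ?_⟩
  rw [← (hlim βs hβs).liminf_eq]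
  refine liminf_le_liminf (Eventually.of_forall fun n => ?_)
  exact le_iSup₂ (f := fun c _ => partitionUtility b lam F U n c) _ (sum_floor_le hK hb hβs n)
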